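/- **Setting.** Consider $\dot x=f(x)+g(x)u$, $x\in\mathbb R^n$, $u\in\mathbb R^m$, on a bounded open safe set $D\ni 0$, with $f,g$ locally Lipschitz and bounded on $D$ and $f(0)=0$. Let $B_f\in C^1(D)$ be a barrier function: $B_f(0)=0$, $B_f>0$ on $D\setminus\{0\}$, and $B_f(x)\to\infty$, $\|\nabla B_f(x)\|\to\infty$ as $x\to\partial D$. Let $\lambda>0$, let $r(x,u)=Q(x)+u^TRu$ with $Q$ continuous and positive definite on $D$ and $R$ symmetric positive definite, and put $R_g=gR^{-1}g^T$. Assume that for some $\rho>0$, $\nabla B_f^TR_g\nabla B_f\ge\rho\|\nabla B_f\|^2$ on $D$ (for instance $\lambda_{\min}(R_g)\ge\rho$). Let $V^*\in C^1(D)$ be positive definite and satisfy $$\nabla V^{*T}(f+gu^*)+r(x,u^*)=0,\qquad u^*=-\tfrac12R^{-1}g^T(\nabla V^*+\lambda\nabla B_f)\quad\text{on }D .$$ Write $V^*=W^T\phi+\epsilon_v$ with a $C^1$ basis $\phi:D\to\mathbb R^N$ with bounded $\nabla\phi$ and ideal weights $\|W\|\le\bar W$; put $R_s=\nabla\phi R_g\nabla\phi^T$.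 **Closed loop** (from time $t_0\ge0$, with $x(t_0)\in D$; all gains positive). $\mathrm{Proj}$ denotes the smooth projection operator: for a ball of radius $\varrho$ with tolerance $\epsilon$, $F(\theta)=(\|\theta\|^2-\varrho^2)/(2\epsilon\varrho+\epsilon^2)$ and $\mathrm{Proj}(\theta,y)=y-F(\theta)\frac{\theta\theta^T}{\|\theta\|^2}y$ if $F(\theta)>0$ and $\theta^Ty>0$, $\mathrm{Proj}(\theta,y)=y$ otherwise; it is applied to matrices column by column, and projected weights (or columns) start in the ball of radius $\varrho+\epsilon$. * Safe control: $\hat u=-\tfrac12R^{-1}g^T(\nabla\phi^T\hat W_a+\lambda\nabla B_f)$. * Identifier, with $\tilde x=x-\hat x$, a $C^1$ activation $\sigma$ that is bounded with bounded derivative, and symmetric positive definite adaptation gains $\Gamma_w,\Gamma_v$: $\dot{\hat x}=\hat F:=\hat W_f^T\sigma(\hat V_f^T\hat x)+\mu+g\hat u$, $\mu=k\tilde x(t)-k\tilde x(t_0)+v$, $\dot v=(k\alpha+\gamma)\tilde x+\beta\,\mathrm{sgn}(\tilde x)$ in the set-valued (Filippov) sense, $v(t_0)=0$, $\dot{\hat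 W}_f=\mathrm{Proj}(\Gamma_w\sigma'\hat V_f^T\dot{\hat x}\tilde x^T)$, $\dot{\hat V}_f=\mathrm{Proj}(\Gamma_v\dot{\hat x}\tilde x^T\hat W_f^T\sigma')$. * Critic, with $\omega=\nabla\phi\,\hat F$, $\delta=\hat W_c^T\omega+r(x,\hat u)$: $\dot{\hat W}_c=-\eta_c\Gamma\frac{\omega}{1+\nu\omega^T\Gamma\omega}\delta$, $\dot\Gamma=-\eta_c\Gamma\frac{\omega\omega^T}{1+\nu\omega^T\Gamma\omega}\Gamma$, $\Gamma(t_0)=\varphi_0I$, where the symmetric matrix $\Gamma$ is reset to $\varphi_0I$ whenever $\lambda_{\min}(\Gamma)$ comes down to $\varphi_1$, $0<\varphi_1<\varphi_0$. * Actor (projection radius $\bar W$, tolerance $\epsilon_a$): $\dot{\hat W}_a=\mathrm{Proj}\big(-\frac{\eta_{a1}}{\sqrt{1+\omega^T\omega}}R_s(\hat W_a-\hat W_c)\delta-\eta_{a2}(\hat W_a-\hat W_c)\big)$. Put $\tilde W_a=W-\hat W_a$, $\tilde W_c=W-\hat W_c$, $\psi=\omega/\sqrt{1+\nu\omega^T\Gamma\omega}$.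 Let $k_a,k_s>0$ satisfy $\|W-\theta\|\le k_a$ whenever $\|\theta\|\le\bar W+\epsilon_a$, and $\|R_s(x)\|\le k_s$ on $D$. Fix $\mu_1,\mu_2,T_{pe}>0$; $\psi$ is called PE if $\mu_1I\le\int_t^{t+T_{pe}}\psi\psi^T\,d\tau\le\mu_2I$ for all $t\ge t_0$. For constants $c_1,\dots,c_4>0$ a solution is said to admit a critic Lyapunov function with these constants if there is $V_c(w,t)$, $t\ge t_0$, with no upward jump in $t$ and with joint derivatives (in time: right derivatives) satisfying $$c_1\|w\|^2\le V_c\le c_2\|w\|^2,\quad \tfrac{\partial V_c}{\partial t}+\tfrac{\partial V_c}{\partial w}\big(-\eta_c\Gamma\psi\psi^Tw\big)\le-c_3\|w\|^2,\quad \big\|\tfrac{\partial V_c}{\partial w}\big\|\le c_4\|w\| .$$ **Theorem.** 1. There are $c_1,\dots,c_4>0$ such that every solution of the closed loop on $[t_0,\infty)$, $t_0\ge 0$, with $\psi$ PE admits a critic Lyapunov function with these constants. 2. Let $c_1,\dots,c_4>0$ satisfy the gain conditions $c_3>\eta_{a1}k_ak_s$ and $4\eta_{a2}>k_s$. Then $x$,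 $\tilde W_a$ and $\tilde W_c$ are uniformly ultimately bounded: there is $b>0$ such that for every compact $K\subset D$ and every $a>0$ there is $T\ge0$ such that for every $t_0\ge0$ and every solution on $[t_0,\infty)$ with $\psi$ PE that admits a critic Lyapunov function with constants $c_1,\dots,c_4$ and has $x(t_0)\in K$, $\|\tilde W_c(t_0)\|\le a$, $\|\hat x(t_0)\|\le a$, one has $\|x(t)\|\le b$, $\|\tilde W_a(t)\|\le b$ and $\|\tilde W_c(t)\|\le b$ for all $t\ge t_0+T$. -/

import Mathlib

open Set Filter Topology MeasureTheory
open scoped RealInnerProductSpace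

noncomputable section

namespace SafeACI

/-- Euclidean space of column vectors of length `n`. -/
abbrev E (n : ℕ) := EuclideanSpace ℝ (Fin n)

/-- The linear map of a square matrix on Euclidean space. -/
def mat {n : ℕ} (A : Matrix (Fin n) (Fin n) ℝ) : E n →L[ℝ] E n :=
  Matrix.toEuclideanCLM (n := Fin n) (𝕜 := ℝ) A

/-- The outer product `v vᵀ`. -/
def outer {n : ℕ} (v : E n) : E n →L[ℝ] E n := (innerSL ℝ v).smulRight v

/-- The convex function of the projection operator: it is `≤ 0` on the ball of radius `ρ` and
`≤ 1` on the ball of radius `ρ + ε`. -/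
def projFun {n : ℕ} (ρ ε : ℝ) (θ : E n) : ℝ := (‖θ‖ ^ 2 - ρ ^ 2) / (2 * ε * ρ + ε ^ 2)

open Classical in
/-- The smooth projection operator of adaptive control,
`Proj(θ, y) = y - F(θ) (∇F ∇Fᵀ / ‖∇F‖²) y` if `F(θ) > 0` and `yᵀ∇F(θ) > 0`, and `y` otherwise,
with `F = projFun ρ ε` (whose gradient is a positive multiple of `θ`). -/
def proj {n : ℕ} (ρ ε : ℝ) (θ y : E n) : E n :=
  if 0 < projFun ρ ε θ ∧ 0 < ⟪θ, y⟫ then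
    y - (projFun ρ ε θ * (⟪θ, y⟫ / ‖θ‖ ^ 2)) • θ
  else y

/-- The plant, the safe optimal control problem, the approximation structure and all gains.
Dimensions: `n` states, `m` inputs, `N` critic/actor basis functions, and an identifier network
with `p` hidden inputs and `q` hidden outputs. -/
structure Data (n m N p q : ℕ) where
  /-- drift -/
  f : E n → E n
  /-- input matrix -/
  g : E n → E m →L[ℝ] E n
  /-- safe region -/
  safeSet : Set (E n)
  /-- barrier function -/
  B : E n → ℝ
  /-- barrier weight -/
  lam : ℝ
  /-- state cost -/
  Q : E n → ℝ
  /-- input cost matrix -/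
  R : Matrix (Fin m) (Fin m) ℝ
  /-- value function -/
  V : E n → ℝ
  /-- critic/actor basis -/
  φ : E n → E N
  /-- ideal critic/actor weights -/
  W : E N
  /-- critic gain `η_c` -/
  etaC : ℝ
  /-- critic normalization gain `ν` -/
  nu : ℝ
  /-- covariance resetting value `φ₀` -/
  phi0 : ℝ
  /-- covariance resetting threshold `φ₁` -/
  phi1 : ℝ
  /-- first actor gain `η_{a1}` -/
  etaA1 : ℝ
  /-- second actor gain `η_{a2}` -/
  etaA2 : ℝ
  /-- radius and tolerance of the actor projection -/
  rhoA : ℝ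
  epsA : ℝ
  /-- identifier activation function -/
  σ : E p → E q
  /-- identifier feedback gains -/
  k : ℝ
  alpha : ℝ
  gam : ℝ
  beta : ℝ
  /-- identifier adaptation gains -/
  gamW : Matrix (Fin q) (Fin q) ℝ
  gamV : Matrix (Fin n) (Fin n) ℝ
  /-- radius and tolerance of the two identifier projections -/
  rhoW : ℝ
  epsW : ℝ
  rhoV : ℝ
  epsV : ℝ

/-- The signals of the closed loop: state, actor and critic weights, critic gain matrix, identifier
state, integral term `v` of the identifier feedback with its selection `s` from the set-valued
sign, and the columns of the two identifier weight matrices. -/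
structure Signals (n N p q : ℕ) where
  x : ℝ → E n
  Wa : ℝ → E N
  Wc : ℝ → E N
  Γ : ℝ → E N →L[ℝ] E N
  xhat : ℝ → E n
  v : ℝ → E n
  s : ℝ → E n
  Wf : ℝ → Fin n → E q
  Vf : ℝ → Fin p → E n

variable {n m N p q : ℕ}

namespace Data

variable (D : Data n m N p q)

/-- Instantaneous cost `r(x,u) = Q(x) + uᵀ R u`. -/
def cost (x : E n) (u : E m) : ℝ := D.Q x + ⟪u, mat D.R u⟫

/-- `R_g = g R⁻¹ gᵀ`. -/
def Rg (x : E n) : E n →L[ℝ] E n :=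
  D.g x ∘L mat D.R⁻¹ ∘L ContinuousLinearMap.adjoint (D.g x)

/-- `∇φ`, the `N × n` Jacobian of the basis. -/
def dφ (x : E n) : E n →L[ℝ] E N := fderiv ℝ D.φ x

/-- `R_s = ∇φ R_g ∇φᵀ`. -/
def Rs (x : E n) : E N →L[ℝ] E N :=
  D.dφ x ∘L D.Rg x ∘L ContinuousLinearMap.adjoint (D.dφ x)

/-- Safe optimal control `u* = -½ R⁻¹ gᵀ (∇V* + λ ∇B_f)`. -/
def uStar (x : E n) : E m :=
  -(1 / 2 : ℝ) • mat D.R⁻¹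
    (ContinuousLinearMap.adjoint (D.g x) (gradient D.V x + D.lam • gradient D.B x))

/-- Safe control law `û = -½ R⁻¹ gᵀ (∇φᵀ Ŵ_a + λ ∇B_f)`. -/
def uHat (x : E n) (Wa : E N) : E m :=
  -(1 / 2 : ℝ) • mat D.R⁻¹
    (ContinuousLinearMap.adjoint (D.g x)
      (ContinuousLinearMap.adjoint (D.dφ x) Wa + D.lam • gradient D.B x))

/-- Standing assumptions on the plant, the barrier, the cost, the value function and the
networks, and positivity of the gains. -/
structure Assumptions : Prop where
  f_lip : LocallyLipschitzOn D.safeSet D.f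
  f_bdd : ∃ C, ∀ x ∈ D.safeSet, ‖D.f x‖ ≤ C
  f_zero : D.f 0 = 0
  g_lip : LocallyLipschitzOn D.safeSet D.g
  g_bdd : ∃ C, ∀ x ∈ D.safeSet, ‖D.g x‖ ≤ C
  safe_open : IsOpen D.safeSet
  safe_bdd : Bornology.IsBounded D.safeSet
  safe_zero : (0 : E n) ∈ D.safeSet
  B_diff : ContDiffOn ℝ 1 D.B D.safeSet
  B_zero : D.B 0 = 0
  B_pos : ∀ x ∈ D.safeSet, x ≠ 0 → 0 < D.B x
  B_top : ∀ y ∈ frontier D.safeSet, Tendsto D.B (𝓝[D.safeSet] y) atTop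
  dB_top : ∀ y ∈ frontier D.safeSet,
    Tendsto (fun x => ‖gradient D.B x‖) (𝓝[D.safeSet] y) atTop
  /-- The input acts along the barrier gradient (implied by `R_g ≥ r I` with `r > 0`). -/
  B_ctrl : ∃ r > 0, ∀ x ∈ D.safeSet,
    r * ‖gradient D.B x‖ ^ 2 ≤ ⟪gradient D.B x, D.Rg x (gradient D.B x)⟫
  lam_pos : 0 < D.lam
  Q_cont : ContinuousOn D.Q D.safeSet
  Q_zero : D.Q 0 = 0
  Q_pos : ∀ x ∈ D.safeSet, x ≠ 0 → 0 < D.Q x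
  R_pos : D.R.PosDef
  V_diff : ContDiffOn ℝ 1 D.V D.safeSet
  V_zero : D.V 0 = 0
  V_pos : ∀ x ∈ D.safeSet, x ≠ 0 → 0 < D.V x
  /-- The Hamilton-Jacobi-Bellman equation `∇V*ᵀ (f + g u*) + r(x, u*) = 0`. -/
  hjb : ∀ x ∈ D.safeSet,
    ⟪gradient D.V x, D.f x + D.g x (D.uStar x)⟫ + D.cost x (D.uStar x) = 0
  φ_diff : ContDiffOn ℝ 1 D.φ D.safeSet
  dφ_bdd : ∃ C, ∀ x ∈ D.safeSet, ‖D.dφ x‖ ≤ C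
  W_bdd : ‖D.W‖ ≤ D.rhoA
  σ_diff : ContDiff ℝ 1 D.σ
  σ_bdd : ∃ C, ∀ y, ‖D.σ y‖ ≤ C
  dσ_bdd : ∃ C, ∀ y, ‖fderiv ℝ D.σ y‖ ≤ C
  etaC_pos : 0 < D.etaC
  nu_pos : 0 < D.nu
  phi1_pos : 0 < D.phi1
  phi_lt : D.phi1 < D.phi0
  etaA1_pos : 0 < D.etaA1
  etaA2_pos : 0 < D.etaA2
  rhoA_pos : 0 < D.rhoA
  epsA_pos : 0 < D.epsA
  k_pos : 0 < D.k
  alpha_pos : 0 < D.alpha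
  gam_pos : 0 < D.gam
  beta_pos : 0 < D.beta
  gamW_pos : D.gamW.PosDef
  gamV_pos : D.gamV.PosDef
  rhoW_pos : 0 < D.rhoW
  epsW_pos : 0 < D.epsW
  rhoV_pos : 0 < D.rhoV
  epsV_pos : 0 < D.epsV

variable (t₀ : ℝ) (S : Signals n N p q) (t : ℝ)

/-- Identification error `x̃ = x - x̂`. -/
def xtil {n N p q : ℕ} (S : Signals n N p q) (t : ℝ) : E n := S.x t - S.xhat t

/-- `V̂_fᵀ y` for the matrix with columns `V̂_f i`. -/
def hidden {n p : ℕ} (Vf : Fin p → E n) (y : E n) : E p := WithLp.toLp 2 fun i => ⟪Vf i, y⟫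

/-- Feedback term `μ = k x̃(t) - k x̃(t₀) + v(t)` of the identifier. -/
def mu : E n := D.k • xtil S t - D.k • xtil S t₀ + S.v t

/-- Identified drift `f̂ = Ŵ_fᵀ σ(V̂_fᵀ x̂) + μ`. -/
def fHat : E n :=
  (WithLp.toLp 2 fun j => ⟪S.Wf t j, D.σ (hidden (S.Vf t) (S.xhat t))⟫ : E n) + D.mu t₀ S t

/-- Identified closed-loop vector field `F̂ = f̂ + g û`. -/
def FHat : E n := D.fHat t₀ S t + D.g (S.x t) (D.uHat (S.x t) (S.Wa t))

/-- Critic regressor `ω = ∇φ F̂`. -/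
def omega : E N := D.dφ (S.x t) (D.FHat t₀ S t)

/-- The normalization `1 + ν ωᵀ Γ ω`. -/
def den : ℝ := 1 + D.nu * ⟪D.omega t₀ S t, S.Γ t (D.omega t₀ S t)⟫

/-- Normalized regressor `ψ = ω / √(1 + ν ωᵀ Γ ω)`. -/
def psi : E N := (Real.sqrt (D.den t₀ S t))⁻¹ • D.omega t₀ S t

/-- Bellman error `δ = Ŵ_cᵀ ω + r(x, û)`. -/
def delta : ℝ := ⟪S.Wc t, D.omega t₀ S t⟫ + D.cost (S.x t) (D.uHat (S.x t) (S.Wa t))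

/-- `S` is a solution on `[t₀, ∞)` of the closed loop made of the plant, the safe control law, the
critic law with covariance resetting, the projected actor law and the identifier. Derivatives are
right derivatives, so that they exist at the resetting instants as well. -/
structure IsSolution : Prop where
  x_init : S.x t₀ ∈ D.safeSet
  x_cont : ContinuousOn S.x (Ici t₀)
  x_ode : ∀ t, t₀ ≤ t → HasDerivWithinAt S.x
    (D.f (S.x t) + D.g (S.x t) (D.uHat (S.x t) (S.Wa t))) (Ici t) t
  Wc_cont : ContinuousOn S.Wc (Ici t₀)
  Wc_ode : ∀ t, t₀ ≤ t → HasDerivWithinAt S.Wc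
    (-(D.etaC * D.delta t₀ S t / D.den t₀ S t) • S.Γ t (D.omega t₀ S t)) (Ici t) t
  Γ_symm : ∀ t, t₀ ≤ t → IsSelfAdjoint (S.Γ t)
  Γ_init : S.Γ t₀ = D.phi0 • ContinuousLinearMap.id ℝ (E N)
  /-- `Γ̇ = -η_c Γ (ω ωᵀ / (1 + ν ωᵀ Γ ω)) Γ`. -/
  Γ_ode : ∀ t, t₀ ≤ t → HasDerivWithinAt S.Γ
    (-(D.etaC / D.den t₀ S t) • (S.Γ t ∘L outer (D.omega t₀ S t) ∘L S.Γ t)) (Ici t) t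
  /-- At every instant either `Γ` is continuous with least eigenvalue above `φ₁`, or the least
  eigenvalue has come down to `φ₁` and `Γ` is reset to `φ₀ I`. -/
  Γ_reset : ∀ t, t₀ < t →
    (ContinuousAt S.Γ t ∧ ∀ w : E N, w ≠ 0 → D.phi1 * ‖w‖ ^ 2 < ⟪w, S.Γ t w⟫) ∨
    (S.Γ t = D.phi0 • ContinuousLinearMap.id ℝ (E N) ∧
      ∃ G : E N →L[ℝ] E N, Tendsto S.Γ (𝓝[<] t) (𝓝 G) ∧
        ∃ w : E N, w ≠ 0 ∧ ⟪w, G w⟫ ≤ D.phi1 * ‖w‖ ^ 2)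
  Wa_init : ‖S.Wa t₀‖ ≤ D.rhoA + D.epsA
  Wa_cont : ContinuousOn S.Wa (Ici t₀)
  /-- `Ŵ_a' = Proj(-(η_{a1} / √(1 + ωᵀω)) R_s (Ŵ_a - Ŵ_c) δ - η_{a2} (Ŵ_a - Ŵ_c))`. -/
  Wa_ode : ∀ t, t₀ ≤ t → HasDerivWithinAt S.Wa
    (proj D.rhoA D.epsA (S.Wa t)
      (-(D.etaA1 * D.delta t₀ S t / Real.sqrt (1 + ‖D.omega t₀ S t‖ ^ 2)) •
          D.Rs (S.x t) (S.Wa t - S.Wc t)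
        - D.etaA2 • (S.Wa t - S.Wc t))) (Ici t) t
  xhat_cont : ContinuousOn S.xhat (Ici t₀)
  xhat_ode : ∀ t, t₀ ≤ t → HasDerivWithinAt S.xhat (D.FHat t₀ S t) (Ici t) t
  s_meas : Measurable S.s
  /-- `s` is a selection of the set-valued componentwise sign of `x̃`. -/
  s_sign : ∀ t, t₀ ≤ t → ∀ i, |S.s t i| ≤ 1 ∧
    (0 < xtil S t i → S.s t i = 1) ∧ (xtil S t i < 0 → S.s t i = -1)
  /-- `v' = (k α + γ) x̃ + β s`, `v(t₀) = 0`. -/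
  v_eq : ∀ t, t₀ ≤ t → S.v t =
    ∫ τ in t₀..t, ((D.k * D.alpha + D.gam) • xtil S τ + D.beta • S.s τ)
  Wf_init : ∀ j, ‖S.Wf t₀ j‖ ≤ D.rhoW + D.epsW
  Wf_cont : ContinuousOn S.Wf (Ici t₀)
  /-- `Ŵ_f' = Proj(Γ_w σ' V̂_fᵀ x̂' x̃ᵀ)`, column by column. -/
  Wf_ode : ∀ t, t₀ ≤ t → ∀ j, HasDerivWithinAt (fun τ => S.Wf τ j)
    (proj D.rhoW D.epsW (S.Wf t j)
      (xtil S t j • mat D.gamW (fderiv ℝ D.σ (hidden (S.Vf t) (S.xhat t))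
        (hidden (S.Vf t) (D.FHat t₀ S t))))) (Ici t) t
  Vf_init : ∀ i, ‖S.Vf t₀ i‖ ≤ D.rhoV + D.epsV
  Vf_cont : ContinuousOn S.Vf (Ici t₀)
  /-- `V̂_f' = Proj(Γ_v x̂' x̃ᵀ Ŵ_fᵀ σ')`, column by column. -/
  Vf_ode : ∀ t, t₀ ≤ t → ∀ i, HasDerivWithinAt (fun τ => S.Vf τ i)
    (proj D.rhoV D.epsV (S.Vf t i)
      ((ContinuousLinearMap.adjoint (fderiv ℝ D.σ (hidden (S.Vf t) (S.xhat t)))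
          (∑ j, xtil S t j • S.Wf t j)) i • mat D.gamV (D.FHat t₀ S t))) (Ici t) t

/-- Nominal critic error dynamics `Ω_nom(w, t) = -η_c Γ ψ ψᵀ w`. -/
def nominal (w : E N) : E N := -D.etaC • S.Γ t (outer (D.psi t₀ S t) w)

/-- `Vc` is a Lyapunov function, with constants `c₁, c₂, c₃, c₄`, certifying global exponential
stability of the nominal critic error dynamics along `S`. Time derivatives are right derivatives,
and `Vc` has no upward jump in time, because `Γ` jumps at the resetting instants. -/
structure IsCriticLyapunov (Vc : E N → ℝ → ℝ) (c₁ c₂ c₃ c₄ : ℝ) : Prop where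
  lower : ∀ w t, t₀ ≤ t → c₁ * ‖w‖ ^ 2 ≤ Vc w t
  upper : ∀ w t, t₀ ≤ t → Vc w t ≤ c₂ * ‖w‖ ^ 2
  deriv : ∀ w t, t₀ ≤ t → ∃ L : E N × ℝ →L[ℝ] ℝ,
    HasFDerivWithinAt (fun z : E N × ℝ => Vc z.1 z.2) L (univ ×ˢ Ici t) (w, t) ∧
    L (D.nominal t₀ S t w, 1) ≤ -c₃ * ‖w‖ ^ 2 ∧
    ‖L ∘L ContinuousLinearMap.inl ℝ (E N) ℝ‖ ≤ c₄ * ‖w‖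
  jump : ∀ w t, t₀ < t → ∀ e > 0, ∀ᶠ τ in 𝓝[<] t, Vc w t ≤ Vc w τ + e

end Data

/-- Persistent excitation on `[t₀, ∞)`: `μ₁ I ≤ ∫_t^{t+T} ψ ψᵀ ≤ μ₂ I` for all `t ≥ t₀`. -/
def IsPE (ψ : ℝ → E N) (t₀ μ₁ μ₂ T : ℝ) : Prop :=
  ∀ t, t₀ ≤ t → ∀ w : E N,
    μ₁ * ‖w‖ ^ 2 ≤ ∫ τ in t..(t + T), ⟪ψ τ, w⟫ ^ 2 ∧
    ∫ τ in t..(t + T), ⟪ψ τ, w⟫ ^ 2 ≤ μ₂ * ‖w‖ ^ 2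

end SafeACI

end

/-!
The critic error bound needs no analysis of the identifier, because the critic law is normalized.

*Critic Lyapunov function.* Coercivity of `Γ` is part of the resetting rule, and `Γ ≤ φ₀ I` because
`Γ` decreases between resets; hence the normalized regressor `ψ` is bounded. Along the nominal
dynamics `wᵀ Γ⁻¹ w` has derivative `-η_c (ψᵀ w)²`, and a reset can only lower it, since it sends
`Γ⁻¹` to its smallest possible value. This weak Lyapunov function is made strict by subtracting
`wᵀ P(t) w` with `P(t) = ∫_t^{t+T} (A(τ) - A(t)) dτ` and `A` a primitive of `ψ ψᵀ`: the derivative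
of `P` is `A(t+T) - A(t) - T ψ ψᵀ`, which persistent excitation bounds below by `μ₁ I - T ψ ψᵀ`,
and the remaining terms are absorbed by a large multiple of `wᵀ Γ⁻¹ w`
(`Data.IsSolution.isCriticLyapunov`). Right-continuity of `ψ` gives the right derivatives.

*Ultimate boundedness.* The projection bounds the actor weights. Near the boundary of the safe set
`‖∇B‖` is large, and `-½ λ ∇Bᵀ R_g ∇B` makes the barrier function decrease at unit rate at least
(`Data.Assumptions.exists_barrier_level`). So the state stays in the safe set and, after a time that
depends only on the initial compact set, in a fixed compact sublevel set of `B`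
(`Data.IsSolution.barrier_le`), where the cost of the control is bounded. The critic error then obeys
the nominal dynamics up to a perturbation `η_c Γ ω (Wᵀ ω + r) / (1 + ν ωᵀ Γ ω)`, bounded
independently of `ω` (`Data.IsSolution.exists_critic_error_deriv`), and the critic Lyapunov function
gives exponential decay to a fixed level (`Data.IsCriticLyapunov.le_level_add_exp`).

All comparisons use right derivatives and a real-induction argument (`le_of_rightDeriv_lt_fence`),
since `Γ` and the Lyapunov function jump at the resetting instants.
-/

noncomputable section

namespace SafeACI

/-! ### Comparison arguments along the half-line -/

/-- Real induction: a property that holds at `a`, passes to left limits and persists for a short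
time to the right holds on all of `[a, b]`. -/
theorem real_induction {P : ℝ → Prop} {a b : ℝ} (ha : P a)
    (hl : ∀ t, a < t → t ≤ b → (∀ τ, a ≤ τ → τ < t → P τ) → P t)
    (hr : ∀ t, a ≤ t → t < b → P t → ∀ᶠ τ in 𝓝[>] t, P τ) :
    ∀ t, a ≤ t → t ≤ b → P t := by
  by_contra! hcon
  obtain ⟨t₁, hat₁, ht₁b, hPt₁⟩ := hcon
  set Z : Set ℝ := {t | a ≤ t ∧ ¬ P t} with hZ
  have hne : Z.Nonempty := ⟨t₁, hat₁, hPt₁⟩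
  have hbdd : BddBelow Z := ⟨a, fun t ht => ht.1⟩
  set i := sInf Z
  have hai : a ≤ i := le_csInf hne fun t ht => ht.1
  have hit₁ : i ≤ t₁ := csInf_le hbdd ⟨hat₁, hPt₁⟩
  have hbelow : ∀ τ, a ≤ τ → τ < i → P τ := fun τ h1 h2 => by
    by_contra h
    exact absurd (csInf_le hbdd ⟨h1, h⟩) (not_le.2 h2)
  have hPi : P i := by
    rcases hai.eq_or_lt with h | h
    · rwa [← h]
    · exact hl i h (hit₁.trans ht₁b) hbelow
  have hib : i < b := by
    refine lt_of_le_of_ne (hit₁.trans ht₁b) fun h => hPt₁ ?_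
    rwa [le_antisymm (ht₁b.trans h.ge) hit₁]
  obtain ⟨u, hiu, hu⟩ := mem_nhdsGT_iff_exists_Ioo_subset.1 (hr i hai hib hPi)
  obtain ⟨z, hz, hzu⟩ := exists_lt_of_csInf_lt hne (show sInf Z < u from hiu)
  have hiz : i ≤ z := csInf_le hbdd hz
  rcases hiz.eq_or_lt with h | h
  · exact hz.2 (h ▸ hPi)
  · exact hz.2 (hu ⟨h, hzu⟩)

/-- A function with right derivatives stays below a fence `u` that it starts below, provided that
it grows more slowly than `u` wherever the two meet and that upward jumps land below the fence. -/
theorem le_of_rightDeriv_lt_fence {y y' u u' : ℝ → ℝ} {a b : ℝ} (ha : y a ≤ u a)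
    (hjump : ∀ t, a < t → t ≤ b → y t ≤ u t ∨ ∀ e > 0, ∃ᶠ τ in 𝓝[<] t, y t ≤ y τ + e)
    (hy : ∀ t, a ≤ t → t < b → HasDerivWithinAt y (y' t) (Ici t) t)
    (hu : ∀ t, HasDerivAt u (u' t) t)
    (hlt : ∀ t, a ≤ t → t < b → y t = u t → y' t < u' t) :
    ∀ t, a ≤ t → t ≤ b → y t ≤ u t := by
  refine real_induction (P := fun t => y t ≤ u t) ha ?_ ?_
  · intro t hat htb hP
    rcases hjump t hat htb with h | hfreq
    · exact h
    refine le_of_forall_pos_le_add fun e he => ?_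
    have hc : ∀ᶠ τ in 𝓝[<] t, u τ < u t + e / 2 :=
      ((hu t).continuousAt.continuousWithinAt.tendsto).eventually
        (eventually_lt_nhds (by linarith))
    have hIoo : ∀ᶠ τ in 𝓝[<] t, τ ∈ Ioo a t := Ioo_mem_nhdsLT hat
    obtain ⟨τ, h1, h2, h3⟩ :=
      ((hfreq (e / 2) (by linarith)).and_eventually (hc.and hIoo)).exists
    have := hP τ h3.1.le h3.2
    linarith
  · intro t hat htb hP
    have hd : HasDerivWithinAt (fun s => y s - u s) (y' t - u' t) (Ioi t) t :=
      ((hy t hat htb).sub (hu t).hasDerivWithinAt).mono Ioi_subset_Ici_self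
    rcases hP.lt_or_eq with h | h
    · have := hd.continuousWithinAt.tendsto.eventually
        (eventually_lt_nhds (show y t - u t < 0 by linarith))
      filter_upwards [this] with τ hτ
      linarith
    · have hneg : y' t - u' t < 0 := by linarith [hlt t hat htb h]
      have hs := (hasDerivWithinAt_iff_tendsto_slope' (by simp)).1 hd
      filter_upwards [hs.eventually (eventually_lt_nhds hneg), self_mem_nhdsWithin] with τ h1 h2
      rw [slope_def_field, h, sub_self, sub_zero, div_lt_iff₀ (by simpa using h2)] at h1
      linarith

/-- The jump condition of the comparison lemma holds at points of left continuity. -/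
theorem frequently_le_add_of_continuousWithinAt {y : ℝ → ℝ} {t : ℝ}
    (h : ContinuousWithinAt y (Iio t) t) : ∀ e > 0, ∃ᶠ τ in 𝓝[<] t, y t ≤ y τ + e := by
  intro e he
  refine Eventually.frequently ?_
  filter_upwards [h.tendsto.eventually (eventually_gt_nhds (show y t - e < y t by linarith))]
    with τ hτ
  linarith

/-- Weak form of the comparison lemma: a function whose right derivative is nonpositive wherever
the function is at least `c`, and whose upward jumps land below `c`, never rises above `c`. -/
theorem le_const_of_rightDeriv_nonpos {y y' : ℝ → ℝ} {a c : ℝ} (ha : y a ≤ c)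
    (hjump : ∀ t, a < t → y t ≤ c ∨ ∀ e > 0, ∃ᶠ τ in 𝓝[<] t, y t ≤ y τ + e)
    (hy : ∀ t, a ≤ t → HasDerivWithinAt y (y' t) (Ici t) t)
    (hle : ∀ t, a ≤ t → c ≤ y t → y' t ≤ 0) (t : ℝ) (hat : a ≤ t) : y t ≤ c := by
  have key : ∀ e > 0, y t ≤ c + e * (t - a) := fun e he =>
    le_of_rightDeriv_lt_fence (u := fun s => c + e * (s - a)) (u' := fun _ => e) (b := t)
      (by simpa using ha) (fun s hs _ => (hjump s hs).imp_left fun h => h.trans (by nlinarith))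
      (fun s hs _ => hy s hs)
      (fun s => by simpa using (((hasDerivAt_id s).sub_const a).const_mul e).const_add c)
      (fun s hs _ h => (hle s hs (by rw [h]; nlinarith)).trans_lt he) t hat le_rfl
  by_contra! h
  rcases hat.eq_or_lt with rfl | hlt
  · linarith
  · have := key ((y t - c) / (2 * (t - a))) (div_pos (by linarith) (by linarith))
    have h2 : (y t - c) / (2 * (t - a)) * (t - a) = (y t - c) / 2 := by
      have : t - a ≠ 0 := by linarith
      field_simp
    linarith

/-- Exponential comparison: `y' ≤ -κ y + κ C` forces `y` below `C + 1` plus an exponentially decaying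
multiple of any bound for its initial value. The margin `1` makes the comparison with the fence
strict. -/
theorem le_add_exp_of_rightDeriv_le {y y' : ℝ → ℝ} {a κ C Y : ℝ} (hκ : 0 < κ) (hC : 0 ≤ C)
    (hY : y a ≤ Y) (hjump : ∀ t, a < t → ∀ e > 0, ∃ᶠ τ in 𝓝[<] t, y t ≤ y τ + e)
    (hy : ∀ t, a ≤ t → HasDerivWithinAt y (y' t) (Ici t) t)
    (hle : ∀ t, a ≤ t → y' t ≤ -κ * y t + κ * C) (t : ℝ) (hat : a ≤ t) :
    y t ≤ C + 1 + Y * Real.exp (-κ * (t - a)) := by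
  refine le_of_rightDeriv_lt_fence (u := fun s => C + 1 + Y * Real.exp (-κ * (s - a)))
    (u' := fun s => Y * (Real.exp (-κ * (s - a)) * (-κ))) (b := t)
    (by simp; linarith) (fun s hs _ => Or.inr (hjump s hs)) (fun s hs _ => hy s hs)
    (fun s => ?_) (fun s hs _ h => ?_) t hat le_rfl
  · have := (((hasDerivAt_id s).sub_const a).const_mul (-κ)).exp
    simpa using (this.const_mul Y).const_add (C + 1)
  · have := hle s hs
    rw [h] at this
    nlinarith

/-! ### Right-continuous functions -/

/-- A right-continuous function is the pointwise limit of its values at the grid points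
`(⌊(k+1) t⌋ + 1) / (k+1)`, which are step functions. -/
theorem stronglyMeasurable_of_continuousWithinAt_Ici {F : Type*} [TopologicalSpace F]
    [TopologicalSpace.PseudoMetrizableSpace F] [SecondCountableTopology F] {h : ℝ → F}
    (hc : ∀ t, ContinuousWithinAt h (Ici t) t) : StronglyMeasurable h := by
  borelize F
  refine Measurable.stronglyMeasurable ?_
  have hgrid : ∀ t : ℝ, Tendsto (fun k : ℕ => ((⌊((k : ℝ) + 1) * t⌋ : ℝ) + 1) / ((k : ℝ) + 1))
      atTop (𝓝[≥] t) := by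
    intro t
    refine tendsto_nhdsWithin_iff.2 ⟨?_, Eventually.of_forall fun k => ?_⟩
    · have h1 : Tendsto (fun k : ℕ => t + 1 / ((k : ℝ) + 1)) atTop (𝓝 t) := by
        simpa using tendsto_one_div_add_atTop_nhds_zero_nat.const_add t
      refine tendsto_of_tendsto_of_tendsto_of_le_of_le tendsto_const_nhds h1 (fun k => ?_)
        fun k => ?_
      · have hk : (0 : ℝ) < k + 1 := by positivity
        change t ≤ _ / _
        rw [le_div_iff₀ hk]
        linarith [Int.lt_floor_add_one (((k : ℝ) + 1) * t)]
      · have hk : (0 : ℝ) < k + 1 := by positivity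
        change _ / _ ≤ t + 1 / _
        have h3 : (t + 1 / ((k : ℝ) + 1)) * (k + 1) = ((k : ℝ) + 1) * t + 1 := by field_simp
        rw [div_le_iff₀ hk, h3]
        linarith [Int.floor_le (((k : ℝ) + 1) * t)]
    · have hk : (0 : ℝ) < k + 1 := by positivity
      change t ≤ _ / _
      rw [le_div_iff₀ hk]
      linarith [Int.lt_floor_add_one (((k : ℝ) + 1) * t)]
  refine measurable_of_tendsto_metrizable (f := fun (k : ℕ) t =>
    h (((⌊((k : ℝ) + 1) * t⌋ : ℝ) + 1) / ((k : ℝ) + 1))) (fun k => ?_)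
    (tendsto_pi_nhds.2 fun t => (hc t).tendsto.comp (hgrid t))
  exact (measurable_from_top (f := fun j : ℤ => h (((j : ℝ) + 1) / ((k : ℝ) + 1)))).comp
    (Int.measurable_floor.comp (measurable_const.mul measurable_id))

/-! ### Sublevel sets of barrier-like functions -/

/-- Sublevel sets of a function that blows up at the frontier of a bounded open set are compact. -/
theorem isCompact_sublevel {n : ℕ} {s : Set (E n)} {h : E n → ℝ} (hs : IsOpen s)
    (hb : Bornology.IsBounded s) (hc : ContinuousOn h s)
    (htop : ∀ y ∈ frontier s, Tendsto h (𝓝[s] y) atTop) (c : ℝ) :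
    IsCompact {x ∈ s | h x ≤ c} := by
  refine Metric.isCompact_of_isClosed_isBounded ?_ (hb.subset fun x hx => hx.1)
  refine isClosed_of_closure_subset fun y hy => ?_
  have hbot : (𝓝[{x ∈ s | h x ≤ c}] y).NeBot := mem_closure_iff_nhdsWithin_neBot.1 hy
  have hle : 𝓝[{x ∈ s | h x ≤ c}] y ≤ 𝓝[s] y := nhdsWithin_mono y fun x hx => hx.1
  have hev : ∀ᶠ x in 𝓝[{x ∈ s | h x ≤ c}] y, h x ≤ c := by
    filter_upwards [self_mem_nhdsWithin] with x hx using hx.2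
  have hys : y ∈ s := by
    by_contra hns
    have hfr : y ∈ frontier s :=
      ⟨closure_mono (fun x hx => hx.1) hy, by rwa [hs.interior_eq]⟩
    obtain ⟨x, h1, h2⟩ :=
      (((htop y hfr).mono_left hle).eventually_gt_atTop c |>.and hev).exists
    exact absurd h2 (not_le.2 h1)
  exact ⟨hys, le_of_tendsto ((hc y hys).tendsto.mono_left hle) hev⟩

/-! ### Symmetric operators between two multiples of the identity -/

section Operators

variable {F : Type*} [NormedAddCommGroup F] [InnerProductSpace ℝ F]

/-- `0 ≤ G ≤ c I` implies `G² ≤ c G`. -/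
theorem norm_sq_apply_le {G : F →L[ℝ] F} {c : ℝ} (hc : 0 < c)
    (hsymm : ∀ u v, ⟪G u, v⟫ = ⟪u, G v⟫) (h0 : ∀ u, 0 ≤ ⟪u, G u⟫)
    (hle : ∀ u, ⟪u, G u⟫ ≤ c * ‖u‖ ^ 2) (u : F) : ‖G u‖ ^ 2 ≤ c * ⟪u, G u⟫ := by
  -- positivity of `G` at `u - c⁻¹ G u`
  have h := h0 (u - c⁻¹ • G u)
  have h2 := hle (G u)
  simp only [map_sub, map_smul, inner_sub_left, inner_sub_right, inner_smul_left,
    inner_smul_right, real_inner_self_eq_norm_sq, ← hsymm u (G u), conj_trivial] at h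
  have h3 : c⁻¹ * (c⁻¹ * ⟪G u, G (G u)⟫) ≤ c⁻¹ * ‖G u‖ ^ 2 := by
    rw [← mul_assoc]
    calc c⁻¹ * c⁻¹ * ⟪G u, G (G u)⟫ ≤ c⁻¹ * c⁻¹ * (c * ‖G u‖ ^ 2) := by gcongr
      _ = c⁻¹ * ‖G u‖ ^ 2 := by field_simp
  have h4 : c⁻¹ * ‖G u‖ ^ 2 ≤ ⟪u, G u⟫ := by linarith
  rwa [inv_mul_le_iff₀ hc] at h4

theorem norm_apply_le_of_form_le {G : F →L[ℝ] F} {c : ℝ} (hc : 0 < c)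
    (hsymm : ∀ u v, ⟪G u, v⟫ = ⟪u, G v⟫) (h0 : ∀ u, 0 ≤ ⟪u, G u⟫)
    (hle : ∀ u, ⟪u, G u⟫ ≤ c * ‖u‖ ^ 2) (u : F) : ‖G u‖ ≤ c * ‖u‖ := by
  have h1 := norm_sq_apply_le hc hsymm h0 hle u
  have h2 := hle u
  refine (sq_le_sq₀ (norm_nonneg _) (by positivity)).1 ?_
  nlinarith

/-- A coercive operator on a finite-dimensional space is invertible. -/
theorem isUnit_of_coercive [FiniteDimensional ℝ F] {G : F →L[ℝ] F} {c : ℝ} (hc : 0 < c)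
    (hge : ∀ u, c * ‖u‖ ^ 2 ≤ ⟪u, G u⟫) : IsUnit G := by
  have hinj : Function.Injective G := by
    refine (injective_iff_map_eq_zero G).2 fun u hu => ?_
    have := hge u
    rw [hu, inner_zero_right] at this
    have : ‖u‖ ^ 2 = 0 := le_antisymm (by nlinarith) (sq_nonneg _)
    simpa using this
  have hu : IsUnit (G : F →ₗ[ℝ] F) := (LinearMap.isUnit_iff_ker_eq_bot _).2
    (LinearMap.ker_eq_bot.2 hinj)
  obtain ⟨H, hH1, hH2⟩ := isUnit_iff_exists.1 hu
  refine isUnit_iff_exists.2 ⟨LinearMap.toContinuousLinearMap H, ?_, ?_⟩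
  · ext v
    simpa using congrArg (fun l : F →ₗ[ℝ] F => l v) hH1
  · ext v
    simpa using congrArg (fun l : F →ₗ[ℝ] F => l v) hH2

end Operators

/-! ### The projection operator -/

/-- Outside the ball of radius `ρ + ε` the projected vector field does not point outwards. -/
theorem inner_proj_nonpos {n : ℕ} {ρ ε : ℝ} (hρ : 0 < ρ) (hε : 0 < ε) {θ : E n}
    (hθ : ρ + ε ≤ ‖θ‖) (y : E n) : ⟪θ, proj ρ ε θ y⟫ ≤ 0 := by
  have hθ0 : 0 < ‖θ‖ := by linarith
  have hF : 1 ≤ projFun ρ ε θ := by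
    unfold projFun
    rw [le_div_iff₀ (by positivity)]
    nlinarith
  unfold proj
  split_ifs with h
  · rw [inner_sub_right, inner_smul_right, real_inner_self_eq_norm_sq]
    have : projFun ρ ε θ * (⟪θ, y⟫ / ‖θ‖ ^ 2) * ‖θ‖ ^ 2 = projFun ρ ε θ * ⟪θ, y⟫ := by
      field_simp
    rw [this]
    nlinarith [h.2]
  · by_contra! hc
    exact h ⟨by linarith, hc⟩

theorem outer_apply {n : ℕ} (v w : E n) : outer v w = ⟪v, w⟫ • v := rfl

theorem norm_outer_le {n : ℕ} (v : E n) : ‖outer v‖ ≤ ‖v‖ ^ 2 := by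
  refine ContinuousLinearMap.opNorm_le_bound _ (by positivity) fun w => ?_
  rw [outer_apply, norm_smul, sq]
  calc ‖⟪v, w⟫‖ * ‖v‖ ≤ ‖v‖ * ‖w‖ * ‖v‖ := by gcongr; exact norm_inner_le_norm v w
    _ = ‖v‖ * ‖v‖ * ‖w‖ := by ring

theorem continuous_outer {n : ℕ} : Continuous (outer (n := n)) := by
  have : outer (n := n) = fun v => ContinuousLinearMap.smulRightL ℝ (E n) (E n) (innerSL ℝ v) v :=
    rfl
  rw [this]
  exact ((ContinuousLinearMap.smulRightL ℝ (E n) (E n)).continuous.comp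
    (innerSL ℝ).continuous).clm_apply continuous_id

namespace Data

variable {n m N p q : ℕ} {D : Data n m N p q} {t₀ t : ℝ} {S : Signals n N p q}

/-! ### The critic gain matrix -/

theorem IsSolution.Γ_inner_symm (h : D.IsSolution t₀ S) (ht : t₀ ≤ t) (u v : E N) :
    ⟪S.Γ t u, v⟫ = ⟪u, S.Γ t v⟫ :=
  (ContinuousLinearMap.isSelfAdjoint_iff_isSymmetric.1 (h.Γ_symm t ht)) u v

theorem IsSolution.phi1_le_Γ (h : D.IsSolution t₀ S) (hD : D.Assumptions) (ht : t₀ ≤ t)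
    (w : E N) : D.phi1 * ‖w‖ ^ 2 ≤ ⟪w, S.Γ t w⟫ := by
  have hreset : S.Γ t = D.phi0 • ContinuousLinearMap.id ℝ (E N) →
      D.phi1 * ‖w‖ ^ 2 ≤ ⟪w, S.Γ t w⟫ := by
    intro hΓ
    rw [hΓ, _root_.smul_apply, inner_smul_right, ContinuousLinearMap.id_apply,
      real_inner_self_eq_norm_sq]
    have := hD.phi_lt
    gcongr
  rcases ht.eq_or_lt with rfl | hlt
  · exact hreset h.Γ_init
  rcases h.Γ_reset t hlt with ⟨-, h2⟩ | ⟨h2, -⟩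
  · rcases eq_or_ne w 0 with rfl | hw
    · simp
    · exact (h2 w hw).le
  · exact hreset h2

theorem IsSolution.one_le_den (h : D.IsSolution t₀ S) (hD : D.Assumptions) (ht : t₀ ≤ t) :
    1 ≤ D.den t₀ S t := by
  have h1 := h.phi1_le_Γ hD ht (D.omega t₀ S t)
  have h2 := hD.nu_pos
  have h3 := hD.phi1_pos
  have h4 : 0 ≤ ⟪D.omega t₀ S t, S.Γ t (D.omega t₀ S t)⟫ := le_trans (by positivity) h1
  unfold den
  nlinarith

/-- The normalization dominates the regressor. -/
theorem IsSolution.norm_omega_sq_div_den_le (h : D.IsSolution t₀ S) (hD : D.Assumptions)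
    (ht : t₀ ≤ t) : ‖D.omega t₀ S t‖ ^ 2 / D.den t₀ S t ≤ 1 / (D.nu * D.phi1) := by
  have h1 := h.phi1_le_Γ hD ht (D.omega t₀ S t)
  have h2 := hD.nu_pos
  have h3 := hD.phi1_pos
  have h4 := h.one_le_den hD ht
  rw [div_le_div_iff₀ (by linarith) (by positivity), one_mul]
  unfold den
  nlinarith

theorem IsSolution.norm_psi_sq_le (h : D.IsSolution t₀ S) (hD : D.Assumptions) (ht : t₀ ≤ t) :
    ‖D.psi t₀ S t‖ ^ 2 ≤ 1 / (D.nu * D.phi1) := by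
  have h4 := h.one_le_den hD ht
  refine le_trans (le_of_eq ?_) (h.norm_omega_sq_div_den_le hD ht)
  rw [psi, norm_smul, mul_pow, norm_inv, inv_pow, Real.norm_eq_abs, sq_abs,
    Real.sq_sqrt (by linarith)]
  ring

/-- Between resets `Γ` decreases, and a reset takes it to `φ₀ I`; hence `Γ ≤ φ₀ I`. -/
theorem IsSolution.Γ_le_phi0 (h : D.IsSolution t₀ S) (hD : D.Assumptions) (ht : t₀ ≤ t)
    (w : E N) : ⟪w, S.Γ t w⟫ ≤ D.phi0 * ‖w‖ ^ 2 := by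
  have hid : ∀ s, S.Γ s = D.phi0 • ContinuousLinearMap.id ℝ (E N) →
      ⟪w, S.Γ s w⟫ ≤ D.phi0 * ‖w‖ ^ 2 := by
    intro s hs
    rw [hs, _root_.smul_apply, inner_smul_right, ContinuousLinearMap.id_apply,
      real_inner_self_eq_norm_sq]
  refine le_const_of_rightDeriv_nonpos (y := fun s => ⟪w, S.Γ s w⟫) (a := t₀) (hid _ h.Γ_init)
    (fun s hs => ?_) (fun s hs => (hasDerivWithinAt_const s (Ici s) w).inner ℝ
      ((h.Γ_ode s hs).clm_apply (hasDerivWithinAt_const s (Ici s) w))) (fun s hs _ => ?_) t ht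
  · rcases h.Γ_reset s hs with ⟨h2, -⟩ | ⟨h2, -⟩
    · refine Or.inr (frequently_le_add_of_continuousWithinAt (y := fun s => ⟪w, S.Γ s w⟫) ?_)
      exact (continuousAt_const.inner (h2.clm_apply continuousAt_const)).continuousWithinAt
    · exact Or.inl (hid s h2)
  · have h1 := h.one_le_den hD hs
    have h2 : 0 ≤ D.etaC / D.den t₀ S s := div_nonneg hD.etaC_pos.le (by linarith)
    simp only [map_zero, add_zero, inner_zero_left, _root_.smul_apply,
      ContinuousLinearMap.comp_apply, outer_apply, map_smul, inner_smul_right,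
      ← h.Γ_inner_symm hs w]
    rw [real_inner_comm (S.Γ s w)]
    nlinarith [mul_nonneg h2 (mul_self_nonneg ⟪S.Γ s w, D.omega t₀ S s⟫)]

theorem IsSolution.Γ_nonneg (h : D.IsSolution t₀ S) (hD : D.Assumptions) (ht : t₀ ≤ t)
    (w : E N) : 0 ≤ ⟪w, S.Γ t w⟫ :=
  le_trans (mul_nonneg hD.phi1_pos.le (sq_nonneg _)) (h.phi1_le_Γ hD ht w)

theorem Assumptions.phi0_pos (hD : D.Assumptions) : 0 < D.phi0 := hD.phi1_pos.trans hD.phi_lt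

theorem IsSolution.norm_Γ_apply_le (h : D.IsSolution t₀ S) (hD : D.Assumptions) (ht : t₀ ≤ t)
    (w : E N) : ‖S.Γ t w‖ ≤ D.phi0 * ‖w‖ :=
  norm_apply_le_of_form_le hD.phi0_pos (h.Γ_inner_symm ht) (h.Γ_nonneg hD ht)
    (h.Γ_le_phi0 hD ht) w

/-! ### The actor weights -/

theorem IsSolution.norm_Wa_le (h : D.IsSolution t₀ S) (hD : D.Assumptions) (ht : t₀ ≤ t) :
    ‖S.Wa t‖ ≤ D.rhoA + D.epsA := by
  have hρ := hD.rhoA_pos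
  have hε := hD.epsA_pos
  refine (sq_le_sq₀ (norm_nonneg _) (by positivity)).1 ?_
  refine le_const_of_rightDeriv_nonpos (y := fun s => ‖S.Wa s‖ ^ 2) (a := t₀)
    (by have := h.Wa_init; gcongr) (fun s hs => Or.inr ?_) (fun s hs => (h.Wa_ode s hs).norm_sq)
    (fun s hs hle => ?_) t ht
  · refine frequently_le_add_of_continuousWithinAt (y := fun s => ‖S.Wa s‖ ^ 2) ?_
    exact (((h.Wa_cont.continuousAt (Ici_mem_nhds hs)).norm).pow 2).continuousWithinAt
  · have h1 := inner_proj_nonpos hρ hε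
      ((sq_le_sq₀ (by positivity) (norm_nonneg (S.Wa s))).1 hle)
    exact mul_nonpos_of_nonneg_of_nonpos zero_le_two (h1 _)

/-! ### The barrier function along the closed loop -/

theorem Assumptions.continuousOn_gradient_B (hD : D.Assumptions) :
    ContinuousOn (gradient D.B) D.safeSet :=
  (InnerProductSpace.toDual ℝ (E n)).symm.continuous.comp_continuousOn
    (hD.B_diff.continuousOn_fderiv_of_isOpen hD.safe_open le_rfl)

theorem Assumptions.continuousOn_dφ (hD : D.Assumptions) : ContinuousOn D.dφ D.safeSet :=
  hD.φ_diff.continuousOn_fderiv_of_isOpen hD.safe_open le_rfl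

/-- Near the boundary of the safe set the barrier function decreases along the closed loop, because
the quadratic term `-½ λ ∇Bᵀ R_g ∇B` dominates when `‖∇B‖` is large. -/
theorem Assumptions.exists_barrier_level (hD : D.Assumptions) :
    ∃ M, ∀ x ∈ D.safeSet, M ≤ D.B x → ∀ θ : E N, ‖θ‖ ≤ D.rhoA + D.epsA →
      ⟪gradient D.B x, D.f x + D.g x (D.uHat x θ)⟫ ≤ -1 := by
  obtain ⟨Cf, hCf⟩ := hD.f_bdd
  obtain ⟨Cg, hCg⟩ := hD.g_bdd
  obtain ⟨Cφ, hCφ⟩ := hD.dφ_bdd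
  obtain ⟨r, hr, hctrl⟩ := hD.B_ctrl
  have hlam := hD.lam_pos
  have hCg0 : 0 ≤ Cg := (norm_nonneg _).trans (hCg 0 hD.safe_zero)
  have hCφ0 : 0 ≤ Cφ := (norm_nonneg _).trans (hCφ 0 hD.safe_zero)
  have hρ : 0 ≤ D.rhoA + D.epsA := (add_pos hD.rhoA_pos hD.epsA_pos).le
  set C : ℝ := Cf + 1 / 2 * (Cg * (‖mat D.R⁻¹‖ * (Cg * (Cφ * (D.rhoA + D.epsA))))) with hC
  set G : ℝ := max 1 (2 * (C + 1) / (D.lam * r)) with hG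
  have hcomp := isCompact_sublevel hD.safe_open hD.safe_bdd hD.continuousOn_gradient_B.norm
    hD.dB_top G
  obtain ⟨M, hM⟩ := hcomp.bddAbove_image (f := D.B)
    (hD.B_diff.continuousOn.mono fun x hx => hx.1)
  refine ⟨M + 1, fun x hx hxM θ hθ => ?_⟩
  have hxG : G < ‖gradient D.B x‖ := by
    by_contra! hle
    have : D.B x ≤ M := hM ⟨x, ⟨hx, hle⟩, rfl⟩
    linarith
  set z := gradient D.B x with hz
  have h1 : 1 < ‖z‖ := (le_max_left _ _).trans_lt hxG
  have h2 : 2 * (C + 1) < D.lam * r * ‖z‖ := by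
    have := (le_max_right _ _).trans_lt hxG
    rwa [div_lt_iff₀' (by positivity)] at this
  have hsplit : D.g x (D.uHat x θ) =
      -(1 / 2 : ℝ) • D.g x (mat D.R⁻¹ (ContinuousLinearMap.adjoint (D.g x)
        (ContinuousLinearMap.adjoint (D.dφ x) θ))) - (D.lam / 2) • D.Rg x z := by
    simp only [uHat, Rg, map_smul, map_add, ContinuousLinearMap.comp_apply, hz]
    module
  have h3 : ⟪z, D.f x⟫ ≤ ‖z‖ * Cf :=
    (real_inner_le_norm _ _).trans (by gcongr; exact hCf x hx)
  have h4 : -⟪z, D.g x (mat D.R⁻¹ (ContinuousLinearMap.adjoint (D.g x)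
        (ContinuousLinearMap.adjoint (D.dφ x) θ)))⟫ ≤
      ‖z‖ * (Cg * (‖mat D.R⁻¹‖ * (Cg * (Cφ * (D.rhoA + D.epsA))))) := by
    refine (neg_le_abs _).trans ((abs_real_inner_le_norm _ _).trans ?_)
    gcongr
    refine (ContinuousLinearMap.le_of_opNorm_le _ (hCg x hx) _).trans ?_
    gcongr
    refine (ContinuousLinearMap.le_opNorm _ _).trans ?_
    gcongr
    refine (ContinuousLinearMap.le_of_opNorm_le _
      ((LinearIsometryEquiv.norm_map _ _).trans_le (hCg x hx)) _).trans ?_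
    gcongr
    refine (ContinuousLinearMap.le_of_opNorm_le _
      ((LinearIsometryEquiv.norm_map _ _).trans_le (hCφ x hx)) _).trans ?_
    gcongr
  have h5 := hctrl x hx
  rw [hsplit, inner_add_right, inner_sub_right, inner_smul_right, inner_smul_right]
  have h6 : D.lam / 2 * (r * ‖z‖ ^ 2) ≤ D.lam / 2 * ⟪z, D.Rg x z⟫ := by gcongr
  have h7 : ‖z‖ * (C + 1) ≤ D.lam / 2 * (r * ‖z‖ ^ 2) := by nlinarith
  have h8 : ‖z‖ * C = ‖z‖ * Cf + 1 / 2 *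
      (‖z‖ * (Cg * (‖mat D.R⁻¹‖ * (Cg * (Cφ * (D.rhoA + D.epsA)))))) := by rw [hC]; ring
  linarith

/-- Sublevel sets of the barrier function above the level `M` are forward invariant. They are compact
subsets of the safe set, so the state cannot reach the boundary. -/
theorem IsSolution.mem_sublevel (h : D.IsSolution t₀ S) (hD : D.Assumptions) {M b : ℝ}
    (hM : ∀ x ∈ D.safeSet, M ≤ D.B x → ∀ θ : E N, ‖θ‖ ≤ D.rhoA + D.epsA →
      ⟪gradient D.B x, D.f x + D.g x (D.uHat x θ)⟫ ≤ -1) (hMb : M ≤ b) {t₁ : ℝ} (ht₁ : t₀ ≤ t₁)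
    (hx : S.x t₁ ∈ D.safeSet) (hb : D.B (S.x t₁) ≤ b) (ht : t₁ ≤ t) :
    S.x t ∈ {x ∈ D.safeSet | D.B x ≤ b} := by
  have hcomp := isCompact_sublevel hD.safe_open hD.safe_bdd hD.B_diff.continuousOn hD.B_top b
  refine real_induction (P := fun t => S.x t ∈ {x ∈ D.safeSet | D.B x ≤ b}) (a := t₁) (b := t)
    ⟨hx, hb⟩ ?_ ?_ t ht le_rfl
  · intro s hs _ hP
    have hc : ContinuousWithinAt S.x (Iio s) s :=
      (h.x_cont.continuousAt (Ici_mem_nhds (ht₁.trans_lt hs))).continuousWithinAt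
    refine hcomp.isClosed.mem_of_tendsto hc.tendsto ?_
    filter_upwards [Ioo_mem_nhdsLT hs] with τ hτ using hP τ hτ.1.le hτ.2
  · intro s hs _ hP
    have hs0 : t₀ ≤ s := ht₁.trans hs
    have hB : HasFDerivAt D.B (fderiv ℝ D.B (S.x s)) (S.x s) :=
      ((hD.B_diff.contDiffAt (hD.safe_open.mem_nhds hP.1)).differentiableAt one_ne_zero).hasFDerivAt
    have hxd := (h.x_ode s hs0).mono Ioi_subset_Ici_self
    have hd := hB.comp_hasDerivWithinAt s hxd
    have hsafe : ∀ᶠ τ in 𝓝[>] s, S.x τ ∈ D.safeSet :=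
      hxd.continuousWithinAt.tendsto.eventually (hD.safe_open.mem_nhds hP.1)
    rcases hP.2.lt_or_eq with hlt | heq
    · filter_upwards [hsafe, hd.continuousWithinAt.tendsto.eventually (eventually_lt_nhds hlt)]
        with τ h1 h2 using ⟨h1, h2.le⟩
    · have hneg := hM _ hP.1 (hMb.trans heq.ge) _ (h.norm_Wa_le hD hs0)
      rw [inner_gradient_left] at hneg
      have hsl := (hasDerivWithinAt_iff_tendsto_slope' (by simp)).1 hd
      filter_upwards [hsafe, hsl.eventually (eventually_lt_nhds (hneg.trans_lt neg_one_lt_zero)),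
        self_mem_nhdsWithin] with τ h1 h2 h3
      rw [slope_def_field, div_lt_iff₀ (by simpa using h3)] at h2
      refine ⟨h1, ?_⟩
      simp only [Function.comp_apply, heq] at h2
      linarith

theorem IsSolution.x_mem (h : D.IsSolution t₀ S) (hD : D.Assumptions) (ht : t₀ ≤ t) :
    S.x t ∈ D.safeSet := by
  obtain ⟨M, hM⟩ := hD.exists_barrier_level
  exact (h.mem_sublevel hD hM (le_max_left M (D.B (S.x t₀))) le_rfl h.x_init (le_max_right _ _)
    ht).1

/-- The barrier function decreases at unit rate down to the level `M`, and stays below it. -/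
theorem IsSolution.barrier_le (h : D.IsSolution t₀ S) (hD : D.Assumptions) {M b : ℝ}
    (hM : ∀ x ∈ D.safeSet, M ≤ D.B x → ∀ θ : E N, ‖θ‖ ≤ D.rhoA + D.epsA →
      ⟪gradient D.B x, D.f x + D.g x (D.uHat x θ)⟫ ≤ -1) (hMb : M ≤ b) (hb : D.B (S.x t₀) ≤ b)
    (ht : t₀ + 2 * (b - M) ≤ t) : S.x t ∈ {x ∈ D.safeSet | D.B x ≤ M} := by
  have hB : ∀ s, t₀ ≤ s → HasFDerivAt D.B (fderiv ℝ D.B (S.x s)) (S.x s) := fun s hs =>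
    ((hD.B_diff.contDiffAt (hD.safe_open.mem_nhds (h.x_mem hD hs))).differentiableAt
      one_ne_zero).hasFDerivAt
  have h1 : t₀ ≤ t₀ + 2 * (b - M) := by linarith
  refine h.mem_sublevel hD hM le_rfl h1 (h.x_mem hD h1) ?_ ht
  have key := le_of_rightDeriv_lt_fence (y := D.B ∘ S.x)
    (u := fun s => b - (s - t₀) / 2) (u' := fun _ => -(1 / 2)) (a := t₀)
    (b := t₀ + 2 * (b - M)) (by simpa using hb)
    (fun s hs _ => Or.inr (frequently_le_add_of_continuousWithinAt
      ((hB s hs.le).continuousAt.comp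
        (h.x_cont.continuousAt (Ici_mem_nhds hs))).continuousWithinAt))
    (fun s hs _ => (hB s hs).comp_hasDerivWithinAt s (h.x_ode s hs))
    (fun s => by simpa using (((hasDerivAt_id s).sub_const t₀).div_const 2).const_sub b)
    (fun s hs hs' heq => ?_) _ h1 le_rfl
  · have : b - (t₀ + 2 * (b - M) - t₀) / 2 = M := by ring
    simpa only [this, Function.comp_apply] using key
  · have hMs : M ≤ D.B (S.x s) := by
      simp only [Function.comp_apply] at heq
      rw [heq]
      linarith
    have := hM _ (h.x_mem hD hs) hMs _ (h.norm_Wa_le hD hs)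
    rw [inner_gradient_left] at this
    linarith

theorem Assumptions.exists_cost_bound (hD : D.Assumptions) {K : Set (E n)} (hK : IsCompact K)
    (hKD : K ⊆ D.safeSet) : ∃ C ≥ 0, ∀ x ∈ K, ∀ θ : E N, ‖θ‖ ≤ D.rhoA + D.epsA →
      |D.cost x (D.uHat x θ)| ≤ C := by
  have hc : ContinuousOn (fun z : E n × E N => D.cost z.1 (D.uHat z.1 z.2))
      (K ×ˢ Metric.closedBall 0 (D.rhoA + D.epsA)) := by
    have hfst : ContinuousOn (fun z : E n × E N => z.1)
      (K ×ˢ Metric.closedBall 0 (D.rhoA + D.epsA)) := continuousOn_fst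
    have hmaps : MapsTo (fun z : E n × E N => z.1)
      (K ×ˢ Metric.closedBall 0 (D.rhoA + D.epsA)) D.safeSet := fun z hz => hKD hz.1
    have hg := hD.g_lip.continuousOn.comp hfst hmaps
    have hφ := hD.continuousOn_dφ.comp hfst hmaps
    have hB := hD.continuousOn_gradient_B.comp hfst hmaps
    have hu : ContinuousOn (fun z : E n × E N => D.uHat z.1 z.2)
        (K ×ˢ Metric.closedBall 0 (D.rhoA + D.epsA)) :=
      ((mat D.R⁻¹).continuous.comp_continuousOn
        (((LinearIsometryEquiv.continuous _).comp_continuousOn hg).clm_apply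
          ((((LinearIsometryEquiv.continuous _).comp_continuousOn hφ).clm_apply
            continuousOn_snd).add (hB.const_smul D.lam)))).const_smul (-(1 / 2 : ℝ))
    exact (hD.Q_cont.comp hfst hmaps).add
      (hu.inner ((mat D.R).continuous.comp_continuousOn hu))
  obtain ⟨C, hC⟩ := (hK.prod (isCompact_closedBall (0 : E N) _)).exists_bound_of_continuousOn hc
  exact ⟨max C 0, le_max_right _ _, fun x hx θ hθ =>
    (hC (x, θ) ⟨hx, by simpa using hθ⟩).trans (le_max_left _ _)⟩

end Data

/-! ### Excitation of a right-continuous bounded regressor -/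

/-- The accumulated excitation `A(t) = ∫₀ᵗ ψ ψᵀ`. -/
def excitation {N : ℕ} (ψ : ℝ → E N) (t : ℝ) : E N →L[ℝ] E N := ∫ τ in (0 : ℝ)..t, outer (ψ τ)

/-- The windowed excitation `P(t) = ∫_t^{t+T} (A(τ) - A(t)) dτ`, written with primitives of `A`.
Its derivative `A(t+T) - A(t) - T ψ ψᵀ` is positive definite under persistent excitation, up to
the term `T ψ ψᵀ`. -/
def windowedExcitation {N : ℕ} (ψ : ℝ → E N) (T t : ℝ) : E N →L[ℝ] E N :=
  (∫ τ in (0 : ℝ)..(t + T), excitation ψ τ) - (∫ τ in (0 : ℝ)..t, excitation ψ τ)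
    - T • excitation ψ t

section Excitation

variable {N : ℕ} {ψ : ℝ → E N} {C : ℝ}

theorem intervalIntegrable_outer (hc : ∀ t, ContinuousWithinAt ψ (Ici t) t)
    (hb : ∀ t, ‖ψ t‖ ^ 2 ≤ C) (a b : ℝ) :
    IntervalIntegrable (fun t => outer (ψ t)) volume a b := by
  have hm : StronglyMeasurable fun t => outer (ψ t) :=
    continuous_outer.comp_stronglyMeasurable (stronglyMeasurable_of_continuousWithinAt_Ici hc)
  exact (intervalIntegrable_const (c := C)).mono_fun hm.aestronglyMeasurable
    (Eventually.of_forall fun t => (norm_outer_le _).trans ((hb t).trans (le_abs_self C)))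

theorem continuous_excitation (hc : ∀ t, ContinuousWithinAt ψ (Ici t) t)
    (hb : ∀ t, ‖ψ t‖ ^ 2 ≤ C) : Continuous (excitation ψ) :=
  intervalIntegral.continuous_primitive (intervalIntegrable_outer hc hb) 0

theorem excitation_sub (hc : ∀ t, ContinuousWithinAt ψ (Ici t) t)
    (hb : ∀ t, ‖ψ t‖ ^ 2 ≤ C) (a b : ℝ) :
    excitation ψ b - excitation ψ a = ∫ τ in a..b, outer (ψ τ) :=
  intervalIntegral.integral_interval_sub_left (intervalIntegrable_outer hc hb _ _)
    (intervalIntegrable_outer hc hb _ _)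

theorem norm_excitation_sub_le (hc : ∀ t, ContinuousWithinAt ψ (Ici t) t)
    (hb : ∀ t, ‖ψ t‖ ^ 2 ≤ C) (a b : ℝ) :
    ‖excitation ψ b - excitation ψ a‖ ≤ C * |b - a| := by
  rw [excitation_sub hc hb]
  exact intervalIntegral.norm_integral_le_of_norm_le_const fun t _ =>
    (norm_outer_le _).trans (hb t)

theorem inner_excitation_sub (hc : ∀ t, ContinuousWithinAt ψ (Ici t) t)
    (hb : ∀ t, ‖ψ t‖ ^ 2 ≤ C) (a b : ℝ) (w : E N) :
    ⟪w, (excitation ψ b - excitation ψ a) w⟫ = ∫ τ in a..b, ⟪ψ τ, w⟫ ^ 2 := by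
  rw [excitation_sub hc hb]
  have := ContinuousLinearMap.intervalIntegral_comp_comm
    (innerSL ℝ w ∘L ContinuousLinearMap.apply ℝ (E N) w) (intervalIntegrable_outer hc hb a b)
  simp only [ContinuousLinearMap.comp_apply, ContinuousLinearMap.apply_apply,
    innerSL_apply_apply] at this
  rw [← this]
  refine intervalIntegral.integral_congr fun τ _ => ?_
  change ⟪w, outer (ψ τ) w⟫ = _
  rw [outer_apply, inner_smul_right, real_inner_comm, sq]

theorem hasDerivWithinAt_excitation (hc : ∀ t, ContinuousWithinAt ψ (Ici t) t)
    (hb : ∀ t, ‖ψ t‖ ^ 2 ≤ C) (t : ℝ) :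
    HasDerivWithinAt (excitation ψ) (outer (ψ t)) (Ici t) t := by
  have hm : StronglyMeasurable fun t => outer (ψ t) :=
    continuous_outer.comp_stronglyMeasurable (stronglyMeasurable_of_continuousWithinAt_Ici hc)
  exact intervalIntegral.integral_hasDerivWithinAt_right (intervalIntegrable_outer hc hb 0 t)
    (t := Ioi t) hm.stronglyMeasurableAtFilter
    ((continuous_outer.continuousAt.comp_continuousWithinAt (hc t)).mono Ioi_subset_Ici_self)

theorem hasDerivWithinAt_windowedExcitation (hc : ∀ t, ContinuousWithinAt ψ (Ici t) t)
    (hb : ∀ t, ‖ψ t‖ ^ 2 ≤ C) (T t : ℝ) :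
    HasDerivWithinAt (windowedExcitation ψ T)
      (excitation ψ (t + T) - excitation ψ t - T • outer (ψ t)) (Ici t) t := by
  have hA := continuous_excitation hc hb
  have h1 : ∀ s, HasDerivAt (fun u => ∫ τ in (0 : ℝ)..u, excitation ψ τ) (excitation ψ s) s :=
    fun s => (hA.integral_hasStrictDerivAt 0 s).hasDerivAt
  exact (((h1 (t + T)).comp_add_const t T).hasDerivWithinAt.sub (h1 t).hasDerivWithinAt).sub
    ((hasDerivWithinAt_excitation hc hb t).const_smul T)

theorem continuous_windowedExcitation (hc : ∀ t, ContinuousWithinAt ψ (Ici t) t)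
    (hb : ∀ t, ‖ψ t‖ ^ 2 ≤ C) (T : ℝ) : Continuous (windowedExcitation ψ T) := by
  have hA := continuous_excitation hc hb
  have h1 : Continuous fun u => ∫ τ in (0 : ℝ)..u, excitation ψ τ :=
    intervalIntegral.continuous_primitive (fun a b => hA.intervalIntegrable a b) 0
  exact ((h1.comp (continuous_add_const T)).sub h1).sub (hA.const_smul T)

theorem norm_windowedExcitation_le (hc : ∀ t, ContinuousWithinAt ψ (Ici t) t)
    (hb : ∀ t, ‖ψ t‖ ^ 2 ≤ C) {T : ℝ} (hT : 0 ≤ T) (t : ℝ) :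
    ‖windowedExcitation ψ T t‖ ≤ C * T ^ 2 := by
  have hC : 0 ≤ C := (sq_nonneg _).trans (hb 0)
  have hA := continuous_excitation hc hb
  have h1 : windowedExcitation ψ T t = ∫ τ in t..(t + T), (excitation ψ τ - excitation ψ t) := by
    rw [intervalIntegral.integral_sub (hA.intervalIntegrable _ _) (by simp),
      intervalIntegral.integral_const, windowedExcitation,
      intervalIntegral.integral_interval_sub_left (hA.intervalIntegrable _ _)
        (hA.intervalIntegrable _ _), add_sub_cancel_left]
  rw [h1]
  refine (intervalIntegral.norm_integral_le_of_norm_le_const (C := C * T) fun τ hτ => ?_).trans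
    (le_of_eq ?_)
  · rw [uIoc_of_le (by linarith)] at hτ
    refine (norm_excitation_sub_le hc hb t τ).trans ?_
    rw [abs_of_nonneg (by linarith [hτ.1])]
    have := hτ.2
    gcongr
    linarith
  · rw [add_sub_cancel_left, abs_of_nonneg hT]
    ring

end Excitation

namespace Data

variable {n m N p q : ℕ} {D : Data n m N p q} {t₀ t : ℝ} {S : Signals n N p q}

/-! ### Continuity of the regressor -/

theorem IsSolution.continuousOn_v (h : D.IsSolution t₀ S) : ContinuousOn S.v (Ici t₀) := by
  have hx : Continuous fun τ => xtil S (max t₀ τ) :=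
    (h.x_cont.sub h.xhat_cont).comp_continuous (continuous_const.max continuous_id)
      fun τ => mem_Ici.2 (le_max_left _ _)
  have hbound : ∀ τ, ‖S.s (max t₀ τ)‖ ≤ Real.sqrt n := fun τ => by
    rw [EuclideanSpace.norm_eq]
    refine Real.sqrt_le_sqrt ?_
    calc ∑ i, ‖S.s (max t₀ τ) i‖ ^ 2 ≤ ∑ _i : Fin n, (1 : ℝ) := Finset.sum_le_sum fun i _ =>
          pow_le_one₀ (norm_nonneg _) (h.s_sign _ (le_max_left _ _) i).1
      _ = n := by simp
  have hmeas : Measurable fun τ => S.s (max t₀ τ) :=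
    h.s_meas.comp (measurable_const.max measurable_id)
  have hs : ∀ a b, IntervalIntegrable (fun τ => S.s (max t₀ τ)) volume a b := fun a b =>
    (intervalIntegrable_const (c := Real.sqrt n)).mono_fun hmeas.aestronglyMeasurable
      (Eventually.of_forall fun τ => (hbound τ).trans (le_abs_self _))
  have hint : ∀ a b, IntervalIntegrable (fun τ => (D.k * D.alpha + D.gam) • xtil S (max t₀ τ) +
      D.beta • S.s (max t₀ τ)) volume a b := fun a b =>
    ((hx.const_smul (D.k * D.alpha + D.gam)).intervalIntegrable a b).add ((hs a b).smul D.beta)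
  have hprim := intervalIntegral.continuous_primitive hint t₀
  refine hprim.continuousOn.congr fun τ hτ => ?_
  rw [h.v_eq τ hτ]
  refine intervalIntegral.integral_congr fun r hr => ?_
  rw [uIcc_of_le hτ] at hr
  simp only [max_eq_right hr.1]

theorem IsSolution.continuousOn_omega (h : D.IsSolution t₀ S) (hD : D.Assumptions) :
    ContinuousOn (D.omega t₀ S) (Ici t₀) := by
  have hmaps : MapsTo S.x (Ici t₀) D.safeSet := fun τ hτ => h.x_mem hD hτ
  have hg := hD.g_lip.continuousOn.comp h.x_cont hmaps
  have hφ := hD.continuousOn_dφ.comp h.x_cont hmaps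
  have hB := hD.continuousOn_gradient_B.comp h.x_cont hmaps
  have hu : ContinuousOn (fun τ => D.uHat (S.x τ) (S.Wa τ)) (Ici t₀) :=
    ((mat D.R⁻¹).continuous.comp_continuousOn
      (((LinearIsometryEquiv.continuous _).comp_continuousOn hg).clm_apply
        ((((LinearIsometryEquiv.continuous _).comp_continuousOn hφ).clm_apply
          h.Wa_cont).add (hB.const_smul D.lam)))).const_smul (-(1 / 2 : ℝ))
  have hhid : ContinuousOn (fun τ => hidden (S.Vf τ) (S.xhat τ)) (Ici t₀) :=
    (PiLp.continuous_toLp 2 _).comp_continuousOn (continuousOn_pi.2 fun i =>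
      ((continuous_apply i).comp_continuousOn h.Vf_cont).inner h.xhat_cont)
  have hnet : ContinuousOn (fun τ =>
      (WithLp.toLp 2 fun j => ⟪S.Wf τ j, D.σ (hidden (S.Vf τ) (S.xhat τ))⟫ : E n)) (Ici t₀) :=
    (PiLp.continuous_toLp 2 _).comp_continuousOn (continuousOn_pi.2 fun j =>
      ((continuous_apply j).comp_continuousOn h.Wf_cont).inner
        (hD.σ_diff.continuous.comp_continuousOn hhid))
  have hmu : ContinuousOn (fun τ => D.mu t₀ S τ) (Ici t₀) :=
    (((h.x_cont.sub h.xhat_cont).const_smul D.k).sub continuousOn_const).add h.continuousOn_v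
  exact hφ.clm_apply ((hnet.add hmu).add (hg.clm_apply hu))

theorem IsSolution.continuousWithinAt_psi (h : D.IsSolution t₀ S) (hD : D.Assumptions)
    (ht : t₀ ≤ t) : ContinuousWithinAt (D.psi t₀ S) (Ici t) t := by
  have hω : ContinuousWithinAt (D.omega t₀ S) (Ici t) t :=
    (h.continuousOn_omega hD t ht).mono (Ici_subset_Ici.2 ht)
  have hΓ := (h.Γ_ode t ht).continuousWithinAt
  have hden : ContinuousWithinAt (D.den t₀ S) (Ici t) t :=
    continuousWithinAt_const.add (continuousWithinAt_const.mul (hω.inner (hΓ.clm_apply hω)))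
  have hpos : Real.sqrt (D.den t₀ S t) ≠ 0 :=
    (Real.sqrt_pos.2 (by linarith [h.one_le_den hD ht])).ne'
  exact ((Real.continuous_sqrt.continuousAt.comp_continuousWithinAt hden).inv₀ hpos).smul hω

/-- The normalized regressor, frozen before the initial time. -/
def psiExt (D : Data n m N p q) (t₀ : ℝ) (S : Signals n N p q) (t : ℝ) : E N :=
  D.psi t₀ S (max t₀ t)

theorem IsSolution.continuousWithinAt_psiExt (h : D.IsSolution t₀ S) (hD : D.Assumptions)
    (t : ℝ) : ContinuousWithinAt (D.psiExt t₀ S) (Ici t) t :=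
  (h.continuousWithinAt_psi hD (le_max_left t₀ t)).comp
    (continuous_const.max continuous_id).continuousWithinAt
    fun _ hτ => mem_Ici.2 (max_le_max le_rfl (mem_Ici.1 hτ))

theorem IsSolution.norm_psiExt_sq_le (h : D.IsSolution t₀ S) (hD : D.Assumptions) (t : ℝ) :
    ‖D.psiExt t₀ S t‖ ^ 2 ≤ 1 / (D.nu * D.phi1) :=
  h.norm_psi_sq_le hD (le_max_left _ _)

theorem psiExt_of_le (ht : t₀ ≤ t) : D.psiExt t₀ S t = D.psi t₀ S t := by
  rw [psiExt, max_eq_right ht]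

/-! ### The inverse of the critic gain matrix -/

theorem IsSolution.isUnit_Γ (h : D.IsSolution t₀ S) (hD : D.Assumptions) (ht : t₀ ≤ t) :
    IsUnit (S.Γ t) :=
  isUnit_of_coercive hD.phi1_pos (h.phi1_le_Γ hD ht)

theorem IsSolution.Γ_inverse_apply (h : D.IsSolution t₀ S) (hD : D.Assumptions) (ht : t₀ ≤ t)
    (w : E N) : S.Γ t (Ring.inverse (S.Γ t) w) = w :=
  congrArg (fun L : E N →L[ℝ] E N => L w) (Ring.mul_inverse_cancel _ (h.isUnit_Γ hD ht))

theorem IsSolution.inverse_Γ_apply (h : D.IsSolution t₀ S) (hD : D.Assumptions) (ht : t₀ ≤ t)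
    (w : E N) : Ring.inverse (S.Γ t) (S.Γ t w) = w :=
  congrArg (fun L : E N →L[ℝ] E N => L w) (Ring.inverse_mul_cancel _ (h.isUnit_Γ hD ht))

/-- `Γ ≤ φ₀ I` gives `Γ⁻¹ ≥ φ₀⁻¹ I`. -/
theorem IsSolution.le_inner_inverse_Γ (h : D.IsSolution t₀ S) (hD : D.Assumptions) (ht : t₀ ≤ t)
    (w : E N) : ‖w‖ ^ 2 ≤ D.phi0 * ⟪w, Ring.inverse (S.Γ t) w⟫ := by
  have := norm_sq_apply_le hD.phi0_pos (h.Γ_inner_symm ht) (h.Γ_nonneg hD ht)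
    (h.Γ_le_phi0 hD ht) (Ring.inverse (S.Γ t) w)
  rwa [h.Γ_inverse_apply hD ht, real_inner_comm] at this

theorem IsSolution.norm_inverse_Γ_le (h : D.IsSolution t₀ S) (hD : D.Assumptions) (ht : t₀ ≤ t) :
    ‖Ring.inverse (S.Γ t)‖ ≤ D.phi1⁻¹ := by
  have h1 := hD.phi1_pos
  refine ContinuousLinearMap.opNorm_le_bound _ (by positivity) fun w => ?_
  rw [inv_mul_eq_div, le_div_iff₀' h1]
  set u := Ring.inverse (S.Γ t) w with hu
  have h2 := h.phi1_le_Γ hD ht u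
  rw [hu, h.Γ_inverse_apply hD ht, ← hu] at h2
  rcases (norm_nonneg u).eq_or_lt with h0 | h0
  · rw [← h0, mul_zero]
    exact norm_nonneg _
  · refine le_of_mul_le_mul_right ?_ h0
    calc D.phi1 * ‖u‖ * ‖u‖ = D.phi1 * ‖u‖ ^ 2 := by ring
      _ ≤ ⟪u, w⟫ := h2
      _ ≤ ‖u‖ * ‖w‖ := real_inner_le_norm _ _
      _ = ‖w‖ * ‖u‖ := mul_comm _ _

theorem IsSolution.outer_psi (h : D.IsSolution t₀ S) (hD : D.Assumptions) (ht : t₀ ≤ t) :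
    outer (D.psi t₀ S t) = (D.den t₀ S t)⁻¹ • outer (D.omega t₀ S t) := by
  ext1 w
  have h1 : (Real.sqrt (D.den t₀ S t))⁻¹ * (Real.sqrt (D.den t₀ S t))⁻¹ = (D.den t₀ S t)⁻¹ := by
    rw [← mul_inv, Real.mul_self_sqrt (by linarith [h.one_le_den hD ht])]
  rw [_root_.smul_apply, outer_apply, outer_apply, psi, inner_smul_left, ← h1,
    conj_trivial]
  module

/-- `(Γ⁻¹)˙ = η_c ψ ψᵀ`. -/
theorem IsSolution.hasDerivWithinAt_inverse_Γ (h : D.IsSolution t₀ S) (hD : D.Assumptions)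
    (ht : t₀ ≤ t) : HasDerivWithinAt (fun τ => Ring.inverse (S.Γ τ))
      (D.etaC • outer (D.psi t₀ S t)) (Ici t) t := by
  obtain ⟨U, hU⟩ := h.isUnit_Γ hD ht
  have h1 := hasFDerivAt_ringInverse (𝕜 := ℝ) U
  rw [hU] at h1
  refine (h1.comp_hasDerivWithinAt t (h.Γ_ode t ht)).congr_deriv ?_
  have h2 : ∀ w, S.Γ t ((U⁻¹ : (E N →L[ℝ] E N)ˣ).val w) = w := fun w => by
    rw [← hU]
    exact congrArg (fun L : E N →L[ℝ] E N => L w) U.mul_inv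
  have h3 : ∀ w, (U⁻¹ : (E N →L[ℝ] E N)ˣ).val (S.Γ t w) = w := fun w => by
    rw [← hU]
    exact congrArg (fun L : E N →L[ℝ] E N => L w) U.inv_mul
  rw [h.outer_psi hD ht]
  ext1 w
  change -((U⁻¹ : (E N →L[ℝ] E N)ˣ).val ((-(D.etaC / D.den t₀ S t) •
    (S.Γ t ∘L outer (D.omega t₀ S t) ∘L S.Γ t)) ((U⁻¹ : (E N →L[ℝ] E N)ˣ).val w))) = _
  rw [_root_.smul_apply, map_smul, ContinuousLinearMap.comp_apply, ContinuousLinearMap.comp_apply,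
    h2, h3, _root_.smul_apply, _root_.smul_apply, smul_smul, neg_smul, neg_neg, div_eq_mul_inv]

/-! ### The critic Lyapunov function -/

/-- The function `κ wᵀ Γ⁻¹ w - wᵀ P(t) w`, where `P` is the windowed excitation of `ψ` over a window
of length `T`. -/
def criticLyapunov (D : Data n m N p q) (t₀ : ℝ) (S : Signals n N p q) (κ T : ℝ) (w : E N)
    (t : ℝ) : ℝ :=
  ⟪w, (κ • Ring.inverse (S.Γ t) - windowedExcitation (D.psiExt t₀ S) T t) w⟫

/-- Along the nominal dynamics `wᵀ Γ⁻¹ w` decreases at rate `η_c (ψᵀ w)²`, and `-wᵀ P w` decreases at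
rate `μ₁ ‖w‖²` up to terms controlled by `(ψᵀ w)²`; a large multiple `κ` of the former absorbs
these. -/
theorem IsSolution.isCriticLyapunov (h : D.IsSolution t₀ S) (hD : D.Assumptions)
    {μ₁ μ₂ T s r κ : ℝ} (hμ₁ : 0 < μ₁) (hT : 0 < T) (hPE : IsPE (D.psi t₀ S) t₀ μ₁ μ₂ T)
    (hs : s = 1 / (D.nu * D.phi1)) (hr : r = D.etaC * (s * T ^ 2) * (D.phi0 * (s + 1)))
    (hκ : κ = D.phi0 * (1 + s * T ^ 2) + (T + 2 * r ^ 2 / μ₁) / D.etaC) :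
    D.IsCriticLyapunov t₀ S (D.criticLyapunov t₀ S κ T) 1 (κ * D.phi1⁻¹ + s * T ^ 2) (μ₁ / 2)
      (2 * (κ * D.phi1⁻¹ + s * T ^ 2)) := by
  have hη := hD.etaC_pos
  have hφ0 := hD.phi0_pos
  have hφ1 := hD.phi1_pos
  have hν := hD.nu_pos
  have hs0 : 0 ≤ s := by rw [hs]; positivity
  have hr0 : 0 ≤ r := by rw [hr]; positivity
  have hκ0 : 0 ≤ κ := by rw [hκ]; positivity
  have hc := h.continuousWithinAt_psiExt hD
  have hb : ∀ t, ‖D.psiExt t₀ S t‖ ^ 2 ≤ s := fun t => by rw [hs]; exact h.norm_psiExt_sq_le hD t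
  have hP := norm_windowedExcitation_le hc hb hT.le
  have hM : ∀ t, t₀ ≤ t →
      ‖κ • Ring.inverse (S.Γ t) - windowedExcitation (D.psiExt t₀ S) T t‖ ≤
        κ * D.phi1⁻¹ + s * T ^ 2 := fun t ht => by
    refine (norm_sub_le _ _).trans (add_le_add ?_ (hP t))
    rw [norm_smul, Real.norm_of_nonneg hκ0]
    gcongr
    exact h.norm_inverse_Γ_le hD ht
  refine ⟨fun w t ht => ?_, fun w t ht => ?_, fun w t ht => ?_, fun w t ht e he => ?_⟩
  · have h1 := h.le_inner_inverse_Γ hD ht w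
    have h2 : ⟪w, windowedExcitation (D.psiExt t₀ S) T t w⟫ ≤ s * T ^ 2 * ‖w‖ ^ 2 := by
      refine (real_inner_le_norm _ _).trans ?_
      have := ContinuousLinearMap.le_of_opNorm_le _ (hP t) w
      calc ‖w‖ * ‖windowedExcitation (D.psiExt t₀ S) T t w‖ ≤ ‖w‖ * (s * T ^ 2 * ‖w‖) := by gcongr
        _ = s * T ^ 2 * ‖w‖ ^ 2 := by ring
    have h3 : D.phi0 * (1 + s * T ^ 2) ≤ κ := by
      rw [hκ]
      exact le_add_of_nonneg_right (by positivity)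
    have h4 : 0 ≤ ⟪w, Ring.inverse (S.Γ t) w⟫ := by
      refine nonneg_of_mul_nonneg_right ((sq_nonneg _).trans h1) hφ0
    have h5 : (1 + s * T ^ 2) * ‖w‖ ^ 2 ≤ κ * ⟪w, Ring.inverse (S.Γ t) w⟫ := calc
      _ ≤ (1 + s * T ^ 2) * (D.phi0 * ⟪w, Ring.inverse (S.Γ t) w⟫) := by gcongr
      _ = D.phi0 * (1 + s * T ^ 2) * ⟪w, Ring.inverse (S.Γ t) w⟫ := by ring
      _ ≤ _ := by gcongr
    rw [criticLyapunov, _root_.sub_apply, _root_.smul_apply, inner_sub_right, inner_smul_right]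
    linarith
  · refine (real_inner_le_norm _ _).trans ?_
    have := ContinuousLinearMap.le_of_opNorm_le _ (hM t ht) w
    calc _ ≤ ‖w‖ * ((κ * D.phi1⁻¹ + s * T ^ 2) * ‖w‖) := by gcongr
      _ = _ := by ring
  · set M := κ • Ring.inverse (S.Γ t) - windowedExcitation (D.psiExt t₀ S) T t with hMdef
    set ψ := D.psi t₀ S t with hψ
    set A := excitation (D.psiExt t₀ S) with hA
    set M' := κ • (D.etaC • outer ψ) - (A (t + T) - A t - T • outer ψ) with hM'
    have hMd : HasDerivWithinAt (fun τ => κ • Ring.inverse (S.Γ τ) -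
        windowedExcitation (D.psiExt t₀ S) T τ) M' (Ici t) t := by
      have h1 := hasDerivWithinAt_windowedExcitation hc hb T t
      rw [psiExt_of_le ht] at h1
      exact ((h.hasDerivWithinAt_inverse_Γ hD ht).const_smul κ).sub h1
    have hfst : HasFDerivWithinAt (fun z : E N × ℝ => z.1) (ContinuousLinearMap.fst ℝ (E N) ℝ)
      (univ ×ˢ Ici t) (w, t) := hasFDerivWithinAt_fst
    have hsnd : HasFDerivWithinAt (fun z : E N × ℝ => z.2) (ContinuousLinearMap.snd ℝ (E N) ℝ)
      (univ ×ˢ Ici t) (w, t) := hasFDerivWithinAt_snd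
    have hMz := HasFDerivWithinAt.comp (w, t) hMd.hasFDerivWithinAt hsnd (fun z hz => hz.2)
    have hV := hfst.inner ℝ (hMz.clm_apply hfst)
    refine ⟨_, hV, ?_, ?_⟩
    · set ν' := D.nominal t₀ S t w with hν'
      have hval : ∀ L : E N × ℝ →L[ℝ] ℝ, (∀ z, L z = ⟪w, M z.1 + z.2 • M' w⟫ + ⟪z.1, M w⟫) →
          L (ν', 1) ≤ -(μ₁ / 2) * ‖w‖ ^ 2 := by
        intro L hL
        rw [hL]
        set a := ⟪ψ, w⟫ with ha
        have hnom : ν' = (-(D.etaC * a)) • S.Γ t ψ := by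
          rw [hν', nominal, outer_apply, map_smul, smul_smul, neg_mul]
        have hJ1 : ⟪w, Ring.inverse (S.Γ t) (S.Γ t ψ)⟫ = a := by
          rw [h.inverse_Γ_apply hD ht, real_inner_comm]
        have hJ2 : ⟪S.Γ t ψ, Ring.inverse (S.Γ t) w⟫ = a := by
          rw [h.Γ_inner_symm ht, h.Γ_inverse_apply hD ht]
        set P := windowedExcitation (D.psiExt t₀ S) T t with hPdef
        have hexc : μ₁ * ‖w‖ ^ 2 ≤ ⟪w, (A (t + T) - A t) w⟫ := by
          rw [inner_excitation_sub hc hb]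
          refine (hPE t ht w).1.trans (le_of_eq ?_)
          refine intervalIntegral.integral_congr fun τ hτ => ?_
          rw [uIcc_of_le (by linarith)] at hτ
          simp only [psiExt_of_le (ht.trans hτ.1)]
        have hΓψ : ‖S.Γ t ψ‖ ≤ D.phi0 * (s + 1) := by
          refine (h.norm_Γ_apply_le hD ht ψ).trans ?_
          have h1 := hb t
          rw [psiExt_of_le ht] at h1
          gcongr
          nlinarith [sq_nonneg (‖ψ‖ - 1)]
        have hcross : ∀ u v : E N, ‖u‖ ≤ D.phi0 * (s + 1) →
            |⟪v, P u⟫| ≤ s * T ^ 2 * (D.phi0 * (s + 1)) * ‖v‖ := fun u v hu => calc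
          |⟪v, P u⟫| ≤ ‖v‖ * ‖P u‖ := abs_real_inner_le_norm _ _
          _ ≤ ‖v‖ * (s * T ^ 2 * (D.phi0 * (s + 1))) := by
            gcongr
            exact (ContinuousLinearMap.le_of_opNorm_le _ (hP t) u).trans (by gcongr)
          _ = _ := mul_comm _ _
        have hcross' : |⟪S.Γ t ψ, P w⟫| ≤ s * T ^ 2 * (D.phi0 * (s + 1)) * ‖w‖ := calc
          |⟪S.Γ t ψ, P w⟫| ≤ ‖S.Γ t ψ‖ * ‖P w‖ := abs_real_inner_le_norm _ _
          _ ≤ D.phi0 * (s + 1) * (s * T ^ 2 * ‖w‖) := by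
            gcongr
            exact ContinuousLinearMap.le_of_opNorm_le _ (hP t) w
          _ = _ := by ring
        have hexp : ⟪w, M ν' + (1 : ℝ) • M' w⟫ + ⟪ν', M w⟫ =
            -(κ * D.etaC) * a ^ 2 + T * a ^ 2 - ⟪w, (A (t + T) - A t) w⟫
              + D.etaC * a * (⟪w, P (S.Γ t ψ)⟫ + ⟪S.Γ t ψ, P w⟫) := by
          have hw : ⟪w, ψ⟫ = a := real_inner_comm _ _
          have hM'w : M' w = (κ * D.etaC * a + T * a) • ψ - (A (t + T) - A t) w := by
            simp only [hM', _root_.sub_apply, _root_.smul_apply, outer_apply, ← ha]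
            module
          have hMν : M ν' = (-(D.etaC * a)) •
              (κ • Ring.inverse (S.Γ t) (S.Γ t ψ) - P (S.Γ t ψ)) := by
            rw [hnom, map_smul]
            rfl
          have hMw : M w = κ • Ring.inverse (S.Γ t) w - P w := rfl
          rw [one_smul, hM'w, hMν, hMw, hnom]
          simp only [inner_add_right, inner_sub_right, inner_smul_right, inner_smul_left, hJ1, hJ2,
            hw, conj_trivial]
          ring
        rw [hexp]
        have hc1 : D.etaC * a * (⟪w, P (S.Γ t ψ)⟫ + ⟪S.Γ t ψ, P w⟫) ≤ 2 * (r * |a| * ‖w‖) := calc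
          _ ≤ |D.etaC * a * (⟪w, P (S.Γ t ψ)⟫ + ⟪S.Γ t ψ, P w⟫)| := le_abs_self _
          _ = D.etaC * |a| * |⟪w, P (S.Γ t ψ)⟫ + ⟪S.Γ t ψ, P w⟫| := by
            rw [abs_mul, abs_mul, abs_of_pos hη]
          _ ≤ D.etaC * |a| * (s * T ^ 2 * (D.phi0 * (s + 1)) * ‖w‖ +
              s * T ^ 2 * (D.phi0 * (s + 1)) * ‖w‖) := by
            gcongr
            exact (abs_add_le _ _).trans (add_le_add (hcross _ _ hΓψ) hcross')
          _ = 2 * (r * |a| * ‖w‖) := by rw [hr]; ring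
        -- Young's inequality absorbs the cross term
        have hyoung : 2 * (r * |a| * ‖w‖) ≤ μ₁ / 2 * ‖w‖ ^ 2 + 2 * r ^ 2 / μ₁ * a ^ 2 := by
          have : μ₁ / 2 * ‖w‖ ^ 2 + 2 * r ^ 2 / μ₁ * a ^ 2 - 2 * (r * |a| * ‖w‖) =
              (μ₁ * ‖w‖ - 2 * r * |a|) ^ 2 / (2 * μ₁) := by
            rw [← sq_abs a]
            field_simp
            ring
          have h2 : 0 ≤ (μ₁ * ‖w‖ - 2 * r * |a|) ^ 2 / (2 * μ₁) := by positivity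
          linarith
        have hκη : T + 2 * r ^ 2 / μ₁ ≤ κ * D.etaC := by
          rw [hκ, add_mul, div_mul_cancel₀ _ hη.ne']
          exact le_add_of_nonneg_left (by positivity)
        have := mul_le_mul_of_nonneg_right hκη (sq_nonneg a)
        linarith
      refine hval _ fun z => ?_
      simp [fderivInnerCLM_apply, hMdef]
    · have hbd : ∀ L : E N →L[ℝ] ℝ, (∀ u, L u = ⟪w, M u⟫ + ⟪u, M w⟫) →
          ‖L‖ ≤ 2 * (κ * D.phi1⁻¹ + s * T ^ 2) * ‖w‖ := by
        intro L hL
        refine ContinuousLinearMap.opNorm_le_bound _ (by positivity) fun u => ?_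
        rw [hL]
        refine (norm_add_le _ _).trans ?_
        have h1 := (norm_inner_le_norm (𝕜 := ℝ) w (M u)).trans (mul_le_mul_of_nonneg_left
          (ContinuousLinearMap.le_of_opNorm_le _ (hM t ht) u) (norm_nonneg w))
        have h2 := (norm_inner_le_norm (𝕜 := ℝ) u (M w)).trans (mul_le_mul_of_nonneg_left
          (ContinuousLinearMap.le_of_opNorm_le _ (hM t ht) w) (norm_nonneg u))
        refine (add_le_add h1 h2).trans (le_of_eq (by ring))
      refine hbd _ fun u => ?_
      simp [fderivInnerCLM_apply, hMdef]
  · have hPc := (continuous_windowedExcitation hc hb T).continuousAt (x := t)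
    have hPw : ContinuousAt (fun τ => ⟪w, windowedExcitation (D.psiExt t₀ S) T τ w⟫) t :=
      continuousAt_const.inner (hPc.clm_apply continuousAt_const)
    have hsplit : ∀ τ, D.criticLyapunov t₀ S κ T w τ = κ * ⟪w, Ring.inverse (S.Γ τ) w⟫ -
        ⟪w, windowedExcitation (D.psiExt t₀ S) T τ w⟫ := fun τ => by
      rw [criticLyapunov, _root_.sub_apply, _root_.smul_apply, inner_sub_right, inner_smul_right]
    have hPev : ∀ᶠ τ in 𝓝[<] t, ⟪w, windowedExcitation (D.psiExt t₀ S) T τ w⟫ <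
        ⟪w, windowedExcitation (D.psiExt t₀ S) T t w⟫ + e / 2 :=
      hPw.continuousWithinAt.tendsto.eventually (eventually_lt_nhds (by linarith))
    have hJev : ∀ᶠ τ in 𝓝[<] t, κ * ⟪w, Ring.inverse (S.Γ t) w⟫ ≤
        κ * ⟪w, Ring.inverse (S.Γ τ) w⟫ + e / 2 := by
      rcases h.Γ_reset t ht with ⟨hcont, -⟩ | ⟨hid, -⟩
      · obtain ⟨U, hU⟩ := h.isUnit_Γ hD ht.le
        have hinv : ContinuousAt (fun τ => Ring.inverse (S.Γ τ)) t :=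
          ContinuousAt.comp (g := Ring.inverse) (hU ▸ NormedRing.inverse_continuousAt U) hcont
        have hJc : ContinuousAt (fun τ => κ * ⟪w, Ring.inverse (S.Γ τ) w⟫) t :=
          continuousAt_const.mul (continuousAt_const.inner (hinv.clm_apply continuousAt_const))
        filter_upwards [hJc.continuousWithinAt.tendsto.eventually (eventually_gt_nhds
          (show κ * ⟪w, Ring.inverse (S.Γ t) w⟫ - e / 2 < _ by linarith))] with τ hτ
        linarith
      · -- a reset sends `Γ⁻¹` to its smallest possible value
        have h0 : ⟪w, Ring.inverse (S.Γ t) w⟫ * D.phi0 = ‖w‖ ^ 2 := by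
          have h1 := h.inverse_Γ_apply hD ht.le w
          rw [hid, _root_.smul_apply, ContinuousLinearMap.id_apply, ← hid, map_smul] at h1
          rw [mul_comm, ← inner_smul_right, h1, real_inner_self_eq_norm_sq]
        filter_upwards [Ioo_mem_nhdsLT ht] with τ hτ
        have h1 := h.le_inner_inverse_Γ hD hτ.1.le w
        have h2 : ⟪w, Ring.inverse (S.Γ t) w⟫ ≤ ⟪w, Ring.inverse (S.Γ τ) w⟫ := by
          refine le_of_mul_le_mul_left ?_ hφ0
          linarith
        have := mul_le_mul_of_nonneg_left h2 hκ0
        linarith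
    filter_upwards [hPev, hJev] with τ h1 h2
    rw [hsplit, hsplit]
    linarith

/-! ### The critic error dynamics -/

/-- Bound on the perturbation of the nominal critic error dynamics when the cost is at most `C`. -/
def perturbationBound (D : Data n m N p q) (C : ℝ) : ℝ :=
  D.etaC * D.phi0 * (‖D.W‖ * (1 / (D.nu * D.phi1)) + C * (1 / (D.nu * D.phi1) + 1))

/-- The critic error satisfies the nominal dynamics up to a perturbation that the normalization
keeps bounded, whatever the size of the regressor. -/
theorem IsSolution.exists_critic_error_deriv (h : D.IsSolution t₀ S) (hD : D.Assumptions)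
    (ht : t₀ ≤ t) {C : ℝ} (hC : |D.cost (S.x t) (D.uHat (S.x t) (S.Wa t))| ≤ C) :
    ∃ d : E N, ‖d‖ ≤ D.perturbationBound C ∧
      HasDerivWithinAt (fun τ => D.W - S.Wc τ) (D.nominal t₀ S t (D.W - S.Wc t) + d) (Ici t) t := by
  set ω := D.omega t₀ S t with hω
  set c := D.cost (S.x t) (D.uHat (S.x t) (S.Wa t)) with hc
  have hden := h.one_le_den hD ht
  have hden0 : 0 < D.den t₀ S t := by linarith
  have hη := hD.etaC_pos
  have hφ0 := hD.phi0_pos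
  have hC0 : 0 ≤ C := (abs_nonneg _).trans hC
  refine ⟨(D.etaC * (⟪D.W, ω⟫ + c) / D.den t₀ S t) • S.Γ t ω, ?_, ?_⟩
  · have h1 : ‖ω‖ ^ 2 / D.den t₀ S t ≤ 1 / (D.nu * D.phi1) := h.norm_omega_sq_div_den_le hD ht
    have h2 : ‖ω‖ / D.den t₀ S t ≤ 1 / (D.nu * D.phi1) + 1 := by
      have h3 : ‖ω‖ ≤ ‖ω‖ ^ 2 + 1 := by nlinarith [sq_nonneg (‖ω‖ - 1)]
      calc ‖ω‖ / D.den t₀ S t ≤ (‖ω‖ ^ 2 + 1) / D.den t₀ S t := by gcongr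
        _ = ‖ω‖ ^ 2 / D.den t₀ S t + 1 / D.den t₀ S t := add_div _ _ _
        _ ≤ _ := add_le_add h1 (by rw [div_le_one hden0]; exact hden)
    rw [norm_smul, norm_div, norm_mul, Real.norm_of_nonneg hη.le, Real.norm_of_nonneg hden0.le,
      Real.norm_eq_abs]
    have h4 : |⟪D.W, ω⟫ + c| ≤ ‖D.W‖ * ‖ω‖ + C :=
      (abs_add_le _ _).trans (add_le_add (abs_real_inner_le_norm _ _) hC)
    calc D.etaC * |⟪D.W, ω⟫ + c| / D.den t₀ S t * ‖S.Γ t ω‖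
        ≤ D.etaC * (‖D.W‖ * ‖ω‖ + C) / D.den t₀ S t * (D.phi0 * ‖ω‖) := by
          gcongr
          exact h.norm_Γ_apply_le hD ht ω
      _ = D.etaC * D.phi0 * (‖D.W‖ * (‖ω‖ ^ 2 / D.den t₀ S t) + C * (‖ω‖ / D.den t₀ S t)) := by
          field_simp
      _ ≤ _ := by
          unfold perturbationBound
          gcongr
  · refine ((h.Wc_ode t ht).const_sub D.W).congr_deriv ?_
    have hnom : D.nominal t₀ S t (D.W - S.Wc t) =
        (-(D.etaC * ⟪ω, D.W - S.Wc t⟫ / D.den t₀ S t)) • S.Γ t ω := by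
      rw [nominal, h.outer_psi hD ht, _root_.smul_apply, outer_apply, map_smul, map_smul, smul_smul,
        smul_smul]
      congr 1
      ring
    rw [hnom, ← neg_smul, ← add_smul]
    congr 1
    rw [delta, inner_sub_right, real_inner_comm ω D.W, real_inner_comm ω (S.Wc t)]
    ring

/-- Along the critic error the Lyapunov function has no upward jump, although only its sections at
fixed weights are assumed to have none: the gradient bound makes it locally Lipschitz in the
weights, uniformly in time. -/
theorem IsCriticLyapunov.frequently_le_add {Vc : E N → ℝ → ℝ} {c₁ c₂ c₃ c₄ : ℝ} (hc₄ : 0 < c₄)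
    (hV : D.IsCriticLyapunov t₀ S Vc c₁ c₂ c₃ c₄) {w : ℝ → E N} (ht : t₀ < t)
    (hw : ContinuousAt w t) : ∀ e > 0, ∃ᶠ τ in 𝓝[<] t, Vc (w t) t ≤ Vc (w τ) τ + e := by
  intro e he
  have hlip : ∀ τ, t₀ ≤ τ → ∀ u ∈ Metric.closedBall (0 : E N) (‖w t‖ + 1),
      ∀ v ∈ Metric.closedBall (0 : E N) (‖w t‖ + 1),
        ‖Vc v τ - Vc u τ‖ ≤ c₄ * (‖w t‖ + 1) * ‖v - u‖ := by
    intro τ hτ u hu v hv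
    choose L hL _ hL2 using fun z => hV.deriv z τ hτ
    refine (convex_closedBall (0 : E N) (‖w t‖ + 1)).norm_image_sub_le_of_norm_hasFDerivWithin_le
      (f := fun z => Vc z τ) (f' := fun z => L z ∘L ContinuousLinearMap.inl ℝ (E N) ℝ)
      (fun z _ => ?_) (fun z hz => (hL2 z).trans ?_) hu hv
    · have hin : HasFDerivWithinAt (fun y : E N => (y, τ)) (ContinuousLinearMap.inl ℝ (E N) ℝ)
          (Metric.closedBall (0 : E N) (‖w t‖ + 1)) z :=
        (hasFDerivAt_prodMk_left z τ).hasFDerivWithinAt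
      have hmaps : MapsTo (fun y : E N => (y, τ)) (Metric.closedBall (0 : E N) (‖w t‖ + 1))
          (univ ×ˢ Ici τ) := fun y _ => ⟨mem_univ _, self_mem_Ici⟩
      exact HasFDerivWithinAt.comp (g := fun z : E N × ℝ => Vc z.1 z.2) z (hL z) hin hmaps
    · have : ‖z‖ ≤ ‖w t‖ + 1 := by simpa using hz
      gcongr
  set K := c₄ * (‖w t‖ + 1) with hK
  have hK0 : 0 < K := by positivity
  have hnear : ∀ᶠ τ in 𝓝[<] t, dist (w τ) (w t) < min 1 (e / (2 * K)) :=
    hw.continuousWithinAt.tendsto.eventually (Metric.ball_mem_nhds _ (by positivity))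
  refine Eventually.frequently ?_
  filter_upwards [hnear, hV.jump (w t) t ht (e / 2) (by linarith), Ioo_mem_nhdsLT ht]
    with τ h1 h2 h3
  rw [dist_eq_norm] at h1
  have hwτ : ‖w τ‖ ≤ ‖w t‖ + 1 := by
    have : ‖w τ‖ ≤ ‖w t‖ + ‖w τ - w t‖ := norm_le_norm_add_norm_sub' _ _
    linarith [h1.le.trans (min_le_left _ _)]
  have h4 := hlip τ h3.1.le (w τ) (by simpa using hwτ) (w t) (by simp)
  have h5 : K * ‖w t - w τ‖ ≤ e / 2 := by
    rw [norm_sub_rev]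
    calc K * ‖w τ - w t‖ ≤ K * (e / (2 * K)) := by
          gcongr
          exact h1.le.trans (min_le_right _ _)
      _ = e / 2 := by field_simp
  have h6 := (le_abs_self _).trans (h4.trans h5)
  linarith

/-- The level below which the critic Lyapunov function ultimately settles, up to any positive margin,
when the cost is at most `C`: above it the decay at rate `c₃` outweighs the perturbation. -/
def criticLevel (D : Data n m N p q) (c₂ c₃ c₄ C : ℝ) : ℝ :=
  c₂ / c₃ * (c₄ ^ 2 * D.perturbationBound C ^ 2 / c₃)

/-- Along the critic error the Lyapunov function obeys `V' ≤ -κ V + κ L`, with `κ = c₃ / (2 c₂)` and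
`L` the critic level, so it relaxes exponentially. -/
theorem IsCriticLyapunov.le_level_add_exp {Vc : E N → ℝ → ℝ} {c₁ c₂ c₃ c₄ C Y t₁ : ℝ}
    (hV : D.IsCriticLyapunov t₀ S Vc c₁ c₂ c₃ c₄) (h : D.IsSolution t₀ S) (hD : D.Assumptions)
    (hc₂ : 0 < c₂) (hc₃ : 0 < c₃) (hc₄ : 0 < c₄) (ht₁ : t₀ ≤ t₁)
    (hC : ∀ t, t₁ ≤ t → |D.cost (S.x t) (D.uHat (S.x t) (S.Wa t))| ≤ C)
    (hY : Vc (D.W - S.Wc t₁) t₁ ≤ Y) (ht : t₁ ≤ t) :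
    Vc (D.W - S.Wc t) t ≤
      D.criticLevel c₂ c₃ c₄ C + 1 + Y * Real.exp (-(c₃ / (2 * c₂)) * (t - t₁)) := by
  set Δ := D.perturbationBound C with hΔ
  have hdata : ∀ s, ∃ y' : ℝ, t₁ ≤ s →
      HasDerivWithinAt (fun τ => Vc (D.W - S.Wc τ) τ) y' (Ici s) s ∧
      y' ≤ -(c₃ / (2 * c₂)) * Vc (D.W - S.Wc s) s +
        c₃ / (2 * c₂) * D.criticLevel c₂ c₃ c₄ C := by
    intro s
    by_cases hs : t₁ ≤ s
    swap
    · exact ⟨0, fun h => absurd h hs⟩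
    have hs0 := ht₁.trans hs
    obtain ⟨d, hd, hw⟩ := h.exists_critic_error_deriv hD hs0 (hC s hs)
    obtain ⟨L, hL, hL1, hL2⟩ := hV.deriv (D.W - S.Wc s) s hs0
    set w := D.W - S.Wc s with hwdef
    refine ⟨L (D.nominal t₀ S s w + d, 1), fun _ => ⟨?_, ?_⟩⟩
    · exact HasFDerivWithinAt.comp_hasDerivWithinAt (l := fun z : E N × ℝ => Vc z.1 z.2)
        (f := fun τ => (D.W - S.Wc τ, τ)) s hL (hw.prodMk (hasDerivWithinAt_id s (Ici s)))
        fun τ hτ => ⟨mem_univ _, hτ⟩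
    · have hsplit : L (D.nominal t₀ S s w + d, 1) =
          L (D.nominal t₀ S s w, 1) + (L ∘L ContinuousLinearMap.inl ℝ (E N) ℝ) d := by
        rw [ContinuousLinearMap.comp_apply, ContinuousLinearMap.inl_apply, ← map_add]
        simp
      have hLd : (L ∘L ContinuousLinearMap.inl ℝ (E N) ℝ) d ≤ c₄ * ‖w‖ * Δ :=
        (le_abs_self _).trans ((ContinuousLinearMap.le_of_opNorm_le _ hL2 d).trans (by gcongr))
      -- Young's inequality, and `V ≤ c₂ ‖w‖²`
      have hyoung : c₄ * ‖w‖ * Δ ≤ c₃ / 2 * ‖w‖ ^ 2 + c₄ ^ 2 * Δ ^ 2 / (2 * c₃) := by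
        have h1 : c₃ / 2 * ‖w‖ ^ 2 + c₄ ^ 2 * Δ ^ 2 / (2 * c₃) - c₄ * ‖w‖ * Δ =
            (c₃ * ‖w‖ - c₄ * Δ) ^ 2 / (2 * c₃) := by
          field_simp
          ring
        have h2 : 0 ≤ (c₃ * ‖w‖ - c₄ * Δ) ^ 2 / (2 * c₃) := by positivity
        linarith
      have hup : c₃ / (2 * c₂) * Vc w s ≤ c₃ / 2 * ‖w‖ ^ 2 := calc
        _ ≤ c₃ / (2 * c₂) * (c₂ * ‖w‖ ^ 2) := by
          gcongr
          exact hV.upper w s hs0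
        _ = _ := by field_simp
      have hlev : c₃ / (2 * c₂) * D.criticLevel c₂ c₃ c₄ C = c₄ ^ 2 * Δ ^ 2 / (2 * c₃) := by
        rw [criticLevel, ← hΔ]
        field_simp
      rw [hsplit, hlev]
      linarith
  choose y' hy' using hdata
  refine le_add_exp_of_rightDeriv_le (y := fun τ => Vc (D.W - S.Wc τ) τ) (y' := y')
    (by positivity) (by unfold criticLevel; positivity) hY (fun s hs => ?_)
    (fun s hs => (hy' s hs).1) (fun s hs => (hy' s hs).2) t ht
  have hs0 := ht₁.trans_lt hs
  exact hV.frequently_le_add hc₄ hs0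
    (continuousAt_const.sub (h.Wc_cont.continuousAt (Ici_mem_nhds hs0)))

end Data

end SafeACI

end

theorem mainTheorem1 {n m N p q : ℕ} (D : SafeACI.Data n m N p q) (hD : D.Assumptions)
    (ka ks : ℝ) (hka_pos : 0 < ka) (hks_pos : 0 < ks)
    (hka : ∀ θ : SafeACI.E N, ‖θ‖ ≤ D.rhoA + D.epsA → ‖D.W - θ‖ ≤ ka)
    (hks : ∀ x ∈ D.safeSet, ‖D.Rs x‖ ≤ ks)
    (μ₁ μ₂ Tpe : ℝ) (hμ₁ : 0 < μ₁) (hμ₂ : 0 < μ₂) (hTpe : 0 < Tpe) :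
    (∃ c₁ > 0, ∃ c₂ > 0, ∃ c₃ > 0, ∃ c₄ > 0,
      ∀ t₀ ≥ (0 : ℝ), ∀ S : SafeACI.Signals n N p q, D.IsSolution t₀ S →
        SafeACI.IsPE (D.psi t₀ S) t₀ μ₁ μ₂ Tpe →
        ∃ Vc : SafeACI.E N → ℝ → ℝ, D.IsCriticLyapunov t₀ S Vc c₁ c₂ c₃ c₄) ∧
    (∀ c₁ > 0, ∀ c₂ > 0, ∀ c₃ > 0, ∀ c₄ > 0,
      D.etaA1 * ka * ks < c₃ → ks < 4 * D.etaA2 →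
      ∃ b > 0, ∀ K : Set (SafeACI.E n), IsCompact K → K ⊆ D.safeSet → ∀ a > 0,
        ∃ T ≥ 0, ∀ t₀ ≥ (0 : ℝ), ∀ S : SafeACI.Signals n N p q, D.IsSolution t₀ S →
          SafeACI.IsPE (D.psi t₀ S) t₀ μ₁ μ₂ Tpe →
          (∃ Vc : SafeACI.E N → ℝ → ℝ, D.IsCriticLyapunov t₀ S Vc c₁ c₂ c₃ c₄) →
          S.x t₀ ∈ K → ‖D.W - S.Wc t₀‖ ≤ a → ‖S.xhat t₀‖ ≤ a →
          ∀ t, t₀ + T ≤ t → ‖S.x t‖ ≤ b ∧ ‖D.W - S.Wa t‖ ≤ b ∧ ‖D.W - S.Wc t‖ ≤ b) := by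
  refine ⟨?_, ?_⟩
  · have hη := hD.etaC_pos
    have hφ0 := hD.phi0_pos
    have hφ1 := hD.phi1_pos
    have hν := hD.nu_pos
    obtain ⟨s, hs⟩ : ∃ s, s = 1 / (D.nu * D.phi1) := ⟨_, rfl⟩
    obtain ⟨r, hr⟩ : ∃ r, r = D.etaC * (s * Tpe ^ 2) * (D.phi0 * (s + 1)) := ⟨_, rfl⟩
    obtain ⟨κ, hκ⟩ : ∃ κ, κ = D.phi0 * (1 + s * Tpe ^ 2) + (Tpe + 2 * r ^ 2 / μ₁) / D.etaC :=
      ⟨_, rfl⟩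
    have hs0 : 0 < s := by rw [hs]; positivity
    have hκ0 : 0 < κ := by rw [hκ]; positivity
    exact ⟨1, one_pos, κ * D.phi1⁻¹ + s * Tpe ^ 2, by positivity, μ₁ / 2, by positivity,
      2 * (κ * D.phi1⁻¹ + s * Tpe ^ 2), by positivity,
      fun t₀ _ S hS hPE => ⟨_, hS.isCriticLyapunov hD hμ₁ hTpe hPE hs hr hκ⟩⟩
  · intro c₁ hc₁ c₂ hc₂ c₃ hc₃ c₄ hc₄ _ _
    obtain ⟨M, hM⟩ := hD.exists_barrier_level
    have hcomp := SafeACI.isCompact_sublevel hD.safe_open hD.safe_bdd hD.B_diff.continuousOn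
      hD.B_top
    obtain ⟨CM, -, hCM⟩ := hD.exists_cost_bound (hcomp M) fun x hx => hx.1
    obtain ⟨RD, hRD⟩ := hD.safe_bdd.exists_norm_le
    have hlevel : ∀ C, 0 ≤ D.criticLevel c₂ c₃ c₄ C := fun C => by
      unfold SafeACI.Data.criticLevel
      positivity
    set b := max (max RD ka) (Real.sqrt ((D.criticLevel c₂ c₃ c₄ CM + 2) / c₁)) with hb
    have hkab : ka ≤ b := (le_max_right _ _).trans (le_max_left _ _)
    refine ⟨b, hka_pos.trans_le hkab, fun K hK hKD a ha => ?_⟩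
    obtain ⟨BK, hBK⟩ := hK.bddAbove_image (hD.B_diff.continuousOn.mono hKD)
    set b₀ := max M BK with hb₀
    obtain ⟨C₀, -, hC₀⟩ := hD.exists_cost_bound (hcomp b₀) fun x hx => hx.1
    -- bound for the Lyapunov function during the transient
    set Y := D.criticLevel c₂ c₃ c₄ C₀ + 1 + c₂ * a ^ 2 with hY
    have hY0 : 0 ≤ Y := by
      have := hlevel C₀
      positivity
    have hMb₀ : M ≤ b₀ := le_max_left _ _
    have hY1 : 0 ≤ Y / (c₃ / (2 * c₂)) := by positivity
    refine ⟨2 * (b₀ - M) + Y / (c₃ / (2 * c₂)), by linarith,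
      fun t₀ _ S hS _ ⟨Vc, hV⟩ hx hWc _ t ht => ?_⟩
    have hBx : D.B (S.x t₀) ≤ b₀ := (hBK ⟨_, hx, rfl⟩).trans (le_max_right _ _)
    have ht₁ : t₀ ≤ t₀ + 2 * (b₀ - M) := by linarith
    have ht₁t : t₀ + 2 * (b₀ - M) ≤ t := by linarith
    have ht₀t : t₀ ≤ t := ht₁.trans ht₁t
    refine ⟨?_, (hka _ (hS.norm_Wa_le hD ht₀t)).trans hkab, ?_⟩
    · exact (hRD _ (hS.x_mem hD ht₀t)).trans ((le_max_left _ _).trans (le_max_left _ _))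
    have hV0 : Vc (D.W - S.Wc t₀) t₀ ≤ c₂ * a ^ 2 :=
      (hV.upper _ t₀ le_rfl).trans (by gcongr)
    have hV1 : Vc (D.W - S.Wc (t₀ + 2 * (b₀ - M))) (t₀ + 2 * (b₀ - M)) ≤ Y := by
      refine (hV.le_level_add_exp hS hD hc₂ hc₃ hc₄ le_rfl (C := C₀) (fun s hs =>
        hC₀ _ (hS.mem_sublevel hD hM hMb₀ le_rfl hS.x_init hBx hs) _ (hS.norm_Wa_le hD hs))
        hV0 ht₁).trans ?_
      have hexp : Real.exp (-(c₃ / (2 * c₂)) * (t₀ + 2 * (b₀ - M) - t₀)) ≤ 1 := by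
        refine Real.exp_le_one_iff.2 (mul_nonpos_of_nonpos_of_nonneg ?_ (by linarith))
        exact neg_nonpos.2 (by positivity)
      have := mul_le_mul_of_nonneg_left hexp (show 0 ≤ c₂ * a ^ 2 by positivity)
      linarith
    have hV2 := hV.le_level_add_exp hS hD hc₂ hc₃ hc₄ ht₁ (C := CM) (fun s hs =>
        hCM _ (hS.barrier_le hD hM hMb₀ hBx hs) _ (hS.norm_Wa_le hD (ht₁.trans hs))) hV1 ht₁t
    -- the length of the second phase makes `Y e^{-κ(t-t₁)} ≤ Y e^{-Y} ≤ 1`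
    have hdecay : Y * Real.exp (-(c₃ / (2 * c₂)) * (t - (t₀ + 2 * (b₀ - M)))) ≤ 1 := by
      have h1 : Y ≤ c₃ / (2 * c₂) * (t - (t₀ + 2 * (b₀ - M))) := by
        rw [← div_le_iff₀' (by positivity)]
        linarith
      calc _ ≤ Y * Real.exp (-Y) := by
            gcongr
            linarith
        _ ≤ Real.exp Y * Real.exp (-Y) := by
            gcongr
            linarith [Real.add_one_le_exp Y]
        _ = 1 := by rw [← Real.exp_add, add_neg_cancel, Real.exp_zero]
    have hlow := hV.lower (D.W - S.Wc t) t ht₀t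
    refine le_trans (Real.le_sqrt_of_sq_le ?_) (le_max_right _ _)
    rw [le_div_iff₀ hc₁]
    linarith
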